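/- Let $d\in\{2,3\}$, let $\Omega\subset\mathbb R^d$ be a convex polygonal (polyhedral) bounded domain, partitioned as a disjoint union $\Omega=\Omega_1\cup\Omega_0\cup\Omega_2$, where $\Omega_1,\Omega_2$ are domains (open, connected) and $\Omega_0$ is a smooth closed hypersurface with $\Omega_1$ and $\Omega_2$ on its two sides, $\partial\Omega\subset\partial\Omega_1$, such that for some $\delta_0>0$ the tubular neighbourhood $U_{\delta_0}(\Omega_0)$ is contained in $\Omega$ and the closest point map $U_{\delta_0}(\Omega_0)\to\Omega_0$ is well defined. Fix $i\in\{1,2\}$. Let $\mathcal T_h$ be a conforming partition of $\Omega$ into simplices with mesh parameter $h\in(0,h_0]$ that is shape regular with parameter $\sigma>0$ (each $T$ of diameter $h_T$ contains a ball of radius $h_T/\sigma$) and quasi-uniform with parameter $\kappa>0$ ($h/\kappa\le h_T\le\kappa h$). Let $\mathcal T_{h,i}=\{T\in\mathcal T_h: T\cap\Omega_i\neq\emptyset\}$ be the active mesh, let $\mathcal F_{h,i}$ be the set of its interior faces (the faces shared by two of its elements), and let $\mathcal K_{h,i}=\{T\cap\Omega_i:T\in\mathcal T_{h,i}\}$ and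 $\mathcal E_{h,i}=\{F\cap\Omega_i:F\in\mathcal F_{h,i}\}$ be the cut elements and the cut faces. Let $W_{h,i}$ be the restriction to $\mathcal T_{h,i}$ of the space of discontinuous functions that are affine on each $T\in\mathcal T_h$ and vanish on the boundary faces on $\partial\Omega$. For a face $F$ shared by $T_1,T_2$ put $[\nabla^0 v]=[v]=v|_{T_1}-v|_{T_2}$ and $[\nabla^1 v]=[\nabla v]=\nabla v|_{T_1}-\nabla v|_{T_2}$. For a set of elements, faces, cut elements or cut faces, $\|\cdot\|^2$ with that set as index is the sum of the squared $L^2$ norms over its members. An element $T\in\mathcal T_{h,i}$ has a large intersection if $\gamma\le |T\cap\Omega_i|/h_T^d$, where $\gamma>0$. Let $\mathcal M_{h,i}$ be a macro element partition of $\mathcal T_{h,i}$: every $T\in\mathcal T_{h,i}$ belongs to precisely one macro element $M$, and the set $\mathcal T_{h,i,M}$ of elements of $M$ contains an element $T_M$ with a large intersection to which every element of $\mathcal T_{h,i,M}$ is connected by a chain of elements of $\mathcal T_{h,i,M}$ crossing at most $N$ faces, consecutive elements sharing a face. Let $\mathcal F_{h,i}(M)$ be the set of faces shared by two elements of $\mathcal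 T_{h,i,M}$. Then there is a constant $C$, depending only on the domains $\Omega,\Omega_0,\Omega_1,\Omega_2$ and on $d,i,h_0,\sigma,\kappa,\gamma,N$ (in particular not on $h$, on the mesh and its position relative to $\Omega_0$, on the macro element partition, or on $v$), such that for all $v\in W_{h,i}$ $$\sum_{k=0}^1 h^{2k-1}\|[\nabla^k v]\|^2_{\mathcal F_{h,i}}\le C\Big(\|\nabla v\|^2_{\mathcal K_{h,i}}+h^{-1}\|[v]\|^2_{\mathcal E_{h,i}}+\sum_{M\in\mathcal M_{h,i}}\sum_{k=0}^1 h^{2k-1}\|[\nabla^k v]\|^2_{\mathcal F_{h,i}(M)}\Big).$$ -/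

import Mathlib

open MeasureTheory
open scoped ContDiff Classical

namespace CutDG

/-- Euclidean space `ℝ^d`. -/
abbrev Space (d : ℕ) : Type := EuclideanSpace ℝ (Fin d)

/-- The closed simplex spanned by a finite set of vertices. -/
def simplex {d : ℕ} (s : Finset (Space d)) : Set (Space d) := convexHull ℝ (s : Set (Space d))

/-- The geometric setting: a convex polygonal (polyhedral) domain `Ω`, partitioned by a smooth closed
hypersurface `Ω₀` into the outer domain `Ω₁` and the inner domain `Ω₂`. -/
structure Geometry (d : ℕ) where
  Ω : Set (Space d)
  Ω₀ : Set (Space d)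
  Ω₁ : Set (Space d)
  Ω₂ : Set (Space d)
  nonempty : Ω.Nonempty
  polygonal : ∃ S : Finset (Space d), Ω = interior (convexHull ℝ (S : Set (Space d)))
  isOpen₁ : IsOpen Ω₁
  isOpen₂ : IsOpen Ω₂
  connected₁ : IsConnected Ω₁
  connected₂ : IsConnected Ω₂
  partition : Ω = Ω₁ ∪ Ω₀ ∪ Ω₂
  disjoint₁₂ : Disjoint Ω₁ Ω₂
  disjoint₀₁ : Disjoint Ω₀ Ω₁
  disjoint₀₂ : Disjoint Ω₀ Ω₂
  /-- The interface is closed (compact without boundary). -/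
  compact_interface : IsCompact Ω₀
  /-- The interface is a smooth embedded hypersurface, with `Ω₁` and `Ω₂` on its two sides: locally
  it is the zero set of a smooth function with nonvanishing derivative, and `Ω₁`, `Ω₂` are the sets
  where that function is positive, respectively negative. -/
  smooth_interface : ∀ x ∈ Ω₀, ∃ (U : Set (Space d)) (φ : Space d → ℝ),
    IsOpen U ∧ x ∈ U ∧ U ⊆ Ω ∧ ContDiffOn ℝ ∞ φ U ∧ (∀ y ∈ U, fderiv ℝ φ y ≠ 0) ∧
    (∀ y ∈ U, (y ∈ Ω₀ ↔ φ y = 0) ∧ (y ∈ Ω₁ ↔ 0 < φ y) ∧ (y ∈ Ω₂ ↔ φ y < 0))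
  /-- The outer domain is `Ω₁`. -/
  outer : frontier Ω ⊆ frontier Ω₁
  /-- Some tubular neighbourhood of the interface lies in `Ω` and has a well defined closest point
  mapping. -/
  tubular : ∃ δ₀ : ℝ, 0 < δ₀ ∧ Metric.thickening δ₀ Ω₀ ⊆ Ω ∧
    ∀ x ∈ Metric.thickening δ₀ Ω₀, ∃! p, p ∈ Ω₀ ∧ dist x p = Metric.infDist x Ω₀

/-- The two bulk domains; the indices `0` and `1` stand for `Ω₁` and `Ω₂`. -/
def Geometry.bulk {d : ℕ} (G : Geometry d) (i : Fin 2) : Set (Space d) :=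
  if i = 0 then G.Ω₁ else G.Ω₂

/-- A (conforming) partition of `Ω` into simplices. -/
structure Mesh {d : ℕ} (Ω : Set (Space d)) where
  complex : Geometry.SimplicialComplex ℝ (Space d)
  finite : complex.faces.Finite
  pure : ∀ s ∈ complex.faces, ∃ T ∈ complex.faces, s ⊆ T ∧ T.card = d + 1
  space_eq : complex.space = closure Ω

namespace Mesh

variable {d : ℕ} {Ω : Set (Space d)}

/-- The elements of the mesh: its `d`-dimensional simplices, given by their vertices. -/
noncomputable def elements (𝒯 : Mesh Ω) : Finset (Finset (Space d)) :=
  𝒯.finite.toFinset.filter (fun T => T.card = d + 1)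

/-- The diameter `h_T` of an element. -/
noncomputable def size (T : Finset (Space d)) : ℝ := Metric.diam (simplex T)

/-- Shape regularity with parameter `σ`: every element `T` contains a ball of radius `h_T / σ`. -/
def ShapeRegular (𝒯 : Mesh Ω) (σ : ℝ) : Prop :=
  ∀ T ∈ 𝒯.elements, ∃ x, Metric.closedBall x (size T / σ) ⊆ simplex T

/-- Quasi-uniformity with mesh parameter `h`: all element diameters are comparable to `h`. -/
def QuasiUniform (𝒯 : Mesh Ω) (κ h : ℝ) : Prop :=
  ∀ T ∈ 𝒯.elements, h / κ ≤ size T ∧ size T ≤ κ * h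

/-- The active mesh of a subdomain `D`: the elements that intersect `D`. -/
noncomputable def active (𝒯 : Mesh Ω) (D : Set (Space d)) : Finset (Finset (Space d)) :=
  𝒯.elements.filter (fun T => (simplex T ∩ D).Nonempty)

/-- The space `V_h` of discontinuous piecewise linear polynomials: on each element an affine
function (determined by its restriction to the element), vanishing on all boundary faces. -/
noncomputable def dgSpace (𝒯 : Mesh Ω) : Submodule ℝ (𝒯.elements → (Space d →ᵃ[ℝ] ℝ)) where
  carrier := {v | ∀ (T : 𝒯.elements) (F : Finset (Space d)), F ⊆ T.1 → F.card = d →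
    simplex F ⊆ frontier Ω → ∀ x ∈ simplex F, v T x = 0}
  zero_mem' := by
    intro T F _ _ _ x _
    simp
  add_mem' := by
    intro a b ha hb T F h1 h2 h3 x hx
    simp [ha T F h1 h2 h3 x hx, hb T F h1 h2 h3 x hx]
  smul_mem' := by
    intro c a ha T F h1 h2 h3 x hx
    simp [ha T F h1 h2 h3 x hx]

/-- The inclusion of the active mesh in the mesh. -/
def activeIncl (𝒯 : Mesh Ω) (D : Set (Space d)) (T : 𝒯.active D) : 𝒯.elements :=
  ⟨T.1, Finset.mem_of_mem_filter T.1 T.2⟩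

/-- The active finite element space: the restriction of `V_h` to the active mesh. -/
noncomputable def activeSpace (𝒯 : Mesh Ω) (D : Set (Space d)) :
    Submodule ℝ (𝒯.active D → (Space d →ᵃ[ℝ] ℝ)) :=
  𝒯.dgSpace.map (LinearMap.funLeft ℝ (Space d →ᵃ[ℝ] ℝ) (𝒯.activeIncl D))

end Mesh

section Faces

variable {d : ℕ}

/-- The interior faces of a set `S` of elements: the `(d-1)`-dimensional faces shared by two
different elements of `S`. -/
noncomputable def interiorFaces (S : Finset (Finset (Space d))) : Finset (Finset (Space d)) :=
  (S.biUnion (fun T => T.powersetCard d)).filter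
    (fun F => ∃ T₁ ∈ S, ∃ T₂ ∈ S, T₁ ≠ T₂ ∧ F ⊆ T₁ ∧ F ⊆ T₂)

/-- Two different elements with a common `(d-1)`-dimensional face. -/
def FaceNeighbours (T₁ T₂ : Finset (Space d)) : Prop :=
  T₁ ≠ T₂ ∧ ∃ F : Finset (Space d), F.card = d ∧ F ⊆ T₁ ∧ F ⊆ T₂

/-- The squared jump `[v]²` at a point `x` of a face `F`. The sum runs over the ordered pairs of
elements of `S` that contain `F`; for a face shared by `T₁` and `T₂` the value is
`(v_{T₁}(x) - v_{T₂}(x))²`, see `jumpSq_eq`. -/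
noncomputable def jumpSq {S : Finset (Finset (Space d))} (v : S → (Space d →ᵃ[ℝ] ℝ))
    (F : Finset (Space d)) (x : Space d) : ℝ :=
  (1 / 2) * ∑ T₁ : S with F ⊆ T₁.1, ∑ T₂ : S with F ⊆ T₂.1, (v T₁ x - v T₂ x) ^ 2

/-- The squared norm `|[∇v]|²` of the jump of the full gradient at a point `x` of a face `F`. -/
noncomputable def gradJumpSq {S : Finset (Finset (Space d))} (v : S → (Space d →ᵃ[ℝ] ℝ))
    (F : Finset (Space d)) (x : Space d) : ℝ :=
  (1 / 2) * ∑ T₁ : S with F ⊆ T₁.1, ∑ T₂ : S with F ⊆ T₂.1,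
    ‖gradient (v T₁) x - gradient (v T₂) x‖ ^ 2

theorem jumpSq_eq {S : Finset (Finset (Space d))} (v : S → (Space d →ᵃ[ℝ] ℝ))
    (F : Finset (Space d)) (x : Space d) (T₁ T₂ : S) (hne : T₁ ≠ T₂)
    (hF : ∀ T : S, F ⊆ T.1 ↔ T = T₁ ∨ T = T₂) :
    jumpSq v F x = (v T₁ x - v T₂ x) ^ 2 := by
  have h : (Finset.univ.filter fun T : S => F ⊆ T.1) = {T₁, T₂} := by
    ext T
    simp [hF]
  simp only [jumpSq, h, Finset.sum_pair hne]
  ring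

theorem gradJumpSq_eq {S : Finset (Finset (Space d))} (v : S → (Space d →ᵃ[ℝ] ℝ))
    (F : Finset (Space d)) (x : Space d) (T₁ T₂ : S) (hne : T₁ ≠ T₂)
    (hF : ∀ T : S, F ⊆ T.1 ↔ T = T₁ ∨ T = T₂) :
    gradJumpSq v F x = ‖gradient (v T₁) x - gradient (v T₂) x‖ ^ 2 := by
  have h : (Finset.univ.filter fun T : S => F ⊆ T.1) = {T₁, T₂} := by
    ext T
    simp [hF]
  simp only [gradJumpSq, h, Finset.sum_pair hne,
    norm_sub_rev (gradient (v T₂) x) (gradient (v T₁) x)]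
  simp
  ring

/-- The face terms `∑_{k=0,1} h^{2k-1} ‖[∇^k v]‖²` over a set `𝓕` of faces, integrated with respect
to the `(d-1)`-dimensional surface measure. -/
noncomputable def faceStab (h : ℝ) {S : Finset (Finset (Space d))}
    (v : S → (Space d →ᵃ[ℝ] ℝ)) (𝓕 : Finset (Finset (Space d))) : ℝ :=
  ∑ F ∈ 𝓕, (h⁻¹ * ∫ x in simplex F, jumpSq v F x ∂(μHE[d - 1]) +
    h * ∫ x in simplex F, gradJumpSq v F x ∂(μHE[d - 1]))

/-- The squared norm `‖[v]‖²` over the cut faces `F ∩ D`, `F` an interior face of `S`. -/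
noncomputable def cutJumpNormSq (D : Set (Space d)) {S : Finset (Finset (Space d))}
    (v : S → (Space d →ᵃ[ℝ] ℝ)) : ℝ :=
  ∑ F ∈ interiorFaces S, ∫ x in simplex F ∩ D, jumpSq v F x ∂(μHE[d - 1])

/-- The squared broken norm `‖∇v‖²` over the cut elements `T ∩ D`, `T` in `S`. -/
noncomputable def cutGradNormSq (D : Set (Space d)) {S : Finset (Finset (Space d))}
    (v : S → (Space d →ᵃ[ℝ] ℝ)) : ℝ :=
  ∑ T : S, ∫ x in simplex T.1 ∩ D, ‖gradient (v T) x‖ ^ 2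

/-- An element `T` has a large intersection with `D`: `γ ≤ |T ∩ D| / h_T^d`. -/
def LargeIntersection (D : Set (Space d)) (γ : ℝ) (T : Finset (Space d)) : Prop :=
  γ ≤ volume.real (simplex T ∩ D) / Mesh.size T ^ d

/-- A partition of a set `S` of elements into macro elements with respect to `D`. A macro element is
given by the set of its elements; it contains an element with a large intersection, to which each of
its elements is connected through at most `N` of its interior faces. -/
structure MacroPartition (S : Finset (Finset (Space d))) (D : Set (Space d)) (γ : ℝ) (N : ℕ) where
  macros : Finset (Finset (Finset (Space d)))
  subset : ∀ M ∈ macros, M ⊆ S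
  existsUnique : ∀ T ∈ S, ∃! M, M ∈ macros ∧ T ∈ M
  connected : ∀ M ∈ macros, ∃ TM ∈ M, LargeIntersection D γ TM ∧
    ∀ T ∈ M, ∃ (n : ℕ) (c : ℕ → Finset (Space d)), n ≤ N ∧ c 0 = T ∧ c n = TM ∧
      (∀ j ≤ n, c j ∈ M) ∧ ∀ j < n, FaceNeighbours (c j) (c (j + 1))

end Faces

end CutDG

/-!
# Stabilisation of jumps on cut meshes by macro elements

The bound rests on two facts about the jumps on an active face: they are differences of affine
functions, so that they are controlled by gradients and by values at single points, and the elements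
at the face can be joined through elements and faces on which such information is available.

*Gradients.* On the element `T_M` of a macro element `M` that has a large intersection with the bulk
domain `D`, the constant `∇v` is controlled by its norm on the cut element. The gradient jumps over
the interior faces of `M` transport the bound to all elements of `M` (`norm_gradient_le`).

*Values.* Let `T₁` and `T₂` share a face. The face terms of their macro elements link them with two
elements with a large intersection, at distance of order `h` from each other. These are joined by a
*corridor*: an open connected set `U ⊆ D` of diameter of order `h` which keeps a distance `c h` from
the complement of `D` (`exists_corridors`). A generic path in `U` avoids the `(d - 2)`-skeleton, so
that the elements that meet `U` are connected through `(d - 1)`-dimensional faces that meet `U`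
(`Mesh.reflTransGen_adjAcross`). Such a face `F` contains a scaled copy of itself inside `F ∩ D`, so
`F ∩ D` has measure at least of order `h ^ (d - 1)` (`Mesh.IsRegular.faceConst_mul_le`), and at some
of its points the jump of `v` is bounded by the norm of the jump over the cut face `F ∩ D`
(`exists_mul_sq_sub_le`). Together with the gradient bounds this compares the values on neighbouring
elements at any point nearby, and the number of elements involved is bounded by a comparison of
volumes. This yields `exists_local_bound`; summation over the faces with bounded overlap gives the
theorem.

*Corridors.* `D` has the interior cone property: at the interface because it is the side of a
hypersurface, where a defining function grows in a fixed direction `n`, and at `∂Ω` because `Ω` is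
convex and the interface keeps away from `∂Ω`; it is uniform by compactness. For small `h` one first
translates a point of `T ∩ D` by a small multiple of `h n` inside `T`, which is possible because the
volume of `T ∩ D` exceeds that of a thin layer around `T`; the cone of the point then widens until
it swallows the corresponding point of the other element. For `h` bounded
from below `D` itself, up to a set of small volume, is exhausted by a connected open set at positive
distance from the complement.
-/

namespace CutDG

/-! ### The interior cone property -/

section ConeProperty

variable {E : Type*} [NormedAddCommGroup E] [NormedSpace ℝ E]

/-- The local interior cone property of a set `D` at a point `x₀`: there are an axis `n` and an
opening `θ` such that the truncated cones `⋃_{0 < s ≤ τ} B(y + s n, θ s)` with apex `y` are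
contained in `D` for all `y ∈ D` close to `x₀`. The axis need not be normalised;
for `x₀` in the interior it can be taken to be zero. -/
def LocalCone (D : Set E) (x₀ : E) : Prop :=
  ∃ (n : E) (ε τ θ : ℝ), 0 < ε ∧ 0 < τ ∧ 0 < θ ∧
    ∀ y ∈ D, dist y x₀ < ε → ∀ s, 0 < s → s ≤ τ → Metric.ball (y + s • n) (θ * s) ⊆ D

theorem dist_lt_of_mem_cone {x₀ y n w : E} {ε s θ : ℝ} (hy : dist y x₀ < ε) (hs : 0 < s)
    (hw : w ∈ Metric.ball (y + s • n) (θ * s)) : dist w x₀ < ε + s * (‖n‖ + θ) := by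
  have h1 : dist w x₀ ≤ dist w (y + s • n) + dist (y + s • n) y + dist y x₀ :=
    dist_triangle4 _ _ _ _
  have h2 : dist (y + s • n) y = s * ‖n‖ := by
    simp [dist_eq_norm, norm_smul, abs_of_pos hs]
  have h3 := Metric.mem_ball.1 hw
  nlinarith

theorem localCone_of_isOpen {D : Set E} (hD : IsOpen D) {x₀ : E} (hx : x₀ ∈ D) :
    LocalCone D x₀ := by
  obtain ⟨δ, hδ, hb⟩ := Metric.isOpen_iff.1 hD x₀ hx
  refine ⟨0, δ / 2, δ / 2, 1, by positivity, by positivity, one_pos, ?_⟩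
  intro y _ hyx s hs hsτ w hw
  apply hb
  have := dist_lt_of_mem_cone hyx hs hw
  simp only [norm_zero] at this
  rw [Metric.mem_ball]
  linarith

/-- Where `D` coincides with a convex set `Ω`, the axis points to the centre of a ball in `Ω`: the
cones are parts of the convex hulls of their apices and the ball. -/
theorem localCone_of_convex {D Ω : Set E} (hΩ : Convex ℝ Ω) (hΩi : (interior Ω).Nonempty)
    {x₀ : E} {δ : ℝ} (hδ : 0 < δ) (hD : ∀ y ∈ Metric.ball x₀ δ, y ∈ D ↔ y ∈ Ω) :
    LocalCone D x₀ := by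
  obtain ⟨c, hc⟩ := hΩi
  obtain ⟨ρ, hρ, hb⟩ := Metric.isOpen_iff.1 isOpen_interior c hc
  have hpos : 0 < ‖c - x₀‖ + ρ / 2 := by positivity
  refine ⟨c - x₀, min (ρ / 2) (δ / 2), min 1 (δ / 2 / (‖c - x₀‖ + ρ / 2)), ρ / 2, by positivity,
    by positivity, by positivity, ?_⟩
  intro y hy hyx s hs hsτ w hw
  have hyρ := hyx.trans_le (min_le_left _ _)
  have hyδ := hyx.trans_le (min_le_right _ _)
  have hs1 := hsτ.trans (min_le_left _ _)
  have hs2 := (le_div_iff₀ hpos).1 (hsτ.trans (min_le_right _ _))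
  have hwδ : w ∈ Metric.ball x₀ δ := by
    have := dist_lt_of_mem_cone hyδ hs hw
    rw [Metric.mem_ball]
    linarith
  rw [hD w hwδ]
  have hyΩ : y ∈ Ω := (hD y (by rw [Metric.mem_ball]; linarith)).1 hy
  set e : E := s⁻¹ • (w - (y + s • (c - x₀))) with he
  have hse : s • e = w - (y + s • (c - x₀)) := by
    rw [he, smul_smul, mul_inv_cancel₀ hs.ne', one_smul]
  have hen : ‖e‖ < ρ / 2 := by
    have h3 : ‖s • e‖ < ρ / 2 * s := by
      rw [hse, ← dist_eq_norm]
      exact Metric.mem_ball.1 hw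
    rw [norm_smul, Real.norm_of_nonneg hs.le, mul_comm] at h3
    exact lt_of_mul_lt_mul_right h3 hs.le
  have h4 : y + (c - x₀) + e ∈ Ω := by
    apply interior_subset
    apply hb
    rw [Metric.mem_ball, dist_eq_norm]
    calc ‖y + (c - x₀) + e - c‖ = ‖(y - x₀) + e‖ := by congr 1; abel
      _ ≤ ‖y - x₀‖ + ‖e‖ := norm_add_le _ _
      _ < ρ := by rw [← dist_eq_norm]; linarith
  have h5 := hΩ hyΩ h4 (sub_nonneg.2 hs1) hs.le (by ring)
  convert h5 using 1
  rw [smul_add, smul_add, hse]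
  module

/-- On the positive side of a function `φ` with nonzero derivative the axis is a direction in which
`φ` grows. -/
theorem localCone_of_hasStrictFDerivAt {D : Set E} {x₀ : E} {φ : E → ℝ} {φ' : E →L[ℝ] ℝ}
    (hφ : HasStrictFDerivAt φ φ' x₀) (hφ' : φ' ≠ 0)
    (hD : ∀ᶠ y in nhds x₀, y ∈ D ↔ 0 < φ y) : LocalCone D x₀ := by
  obtain ⟨m, hm⟩ : ∃ m, φ' m ≠ 0 := by
    by_contra! h
    exact hφ' (ContinuousLinearMap.ext h)
  set n : E := (φ' m)⁻¹ • m with hn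
  have hφn : φ' n = 1 := by simp [hn, hm]
  set θ : ℝ := 1 / (4 * (‖φ'‖ + 1)) with hθ
  have hθ0 : 0 < θ := by positivity
  have hθ1 : ‖φ'‖ * θ ≤ 1 / 4 := by
    rw [hθ, mul_one_div, div_le_div_iff₀ (by positivity) (by norm_num)]
    linarith [norm_nonneg φ']
  have hnθ : 0 < ‖n‖ + θ := by positivity
  -- Along a vector of the cone the linear part of `φ` grows by at least `3 s / 4`, and the error of
  -- the linearisation is at most `s / 4`.
  have hlo := hφ.isLittleO.def (show (0 : ℝ) < 1 / (4 * (‖n‖ + θ)) by positivity)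
  rw [nhds_prod_eq] at hlo
  obtain ⟨p, hp, hpp⟩ := Filter.eventually_prod_self_iff'.1 hlo
  obtain ⟨δ, hδ, hball⟩ :=
    Metric.eventually_nhds_iff.1 ((show ∀ᶠ y in nhds x₀, y ∈ p from hp).and hD)
  refine ⟨n, δ / 2, δ / 2 / (‖n‖ + θ), θ, by positivity, by positivity, hθ0, ?_⟩
  intro y hy hyx s hs hsτ w hw
  have hs2 := (le_div_iff₀ hnθ).1 hsτ
  have hwx : dist w x₀ < δ := by
    have := dist_lt_of_mem_cone hyx hs hw
    linarith
  have hyx' : dist y x₀ < δ := by linarith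
  rw [(hball hwx).2]
  have hφy := (hball hyx').2.1 hy
  have h1 := hpp w (hball hwx).1 y (hball hyx').1
  set e : E := w - (y + s • n) with he
  have hen : ‖e‖ ≤ θ * s := by
    rw [he, ← dist_eq_norm]
    exact (Metric.mem_ball.1 hw).le
  have hwy : w - y = s • n + e := by rw [he]; abel
  have hwyn : ‖w - y‖ ≤ s * (‖n‖ + θ) := by
    rw [hwy]
    refine (norm_add_le _ _).trans ?_
    rw [norm_smul, Real.norm_of_nonneg hs.le]
    linarith
  have h2 : φ' (w - y) = s + φ' e := by rw [hwy, map_add, map_smul, hφn, smul_eq_mul, mul_one]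
  have h3 : |φ' e| ≤ s / 4 := by
    calc |φ' e| ≤ ‖φ'‖ * ‖e‖ := φ'.le_opNorm e
      _ ≤ ‖φ'‖ * (θ * s) := by gcongr
      _ = ‖φ'‖ * θ * s := by ring
      _ ≤ 1 / 4 * s := by gcongr
      _ = s / 4 := by ring
  have h4 : 1 / (4 * (‖n‖ + θ)) * ‖w - y‖ ≤ s / 4 := by
    calc 1 / (4 * (‖n‖ + θ)) * ‖w - y‖ ≤ 1 / (4 * (‖n‖ + θ)) * (s * (‖n‖ + θ)) := by gcongr
      _ = s / 4 := by field_simp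
  have h5 := h1.trans h4
  simp only [Real.norm_eq_abs, h2] at h5
  have h6 := (abs_le.1 h5).1
  have h7 := (abs_le.1 h3).1
  linarith

/-- By compactness the local interior cone properties hold with common parameters. -/
theorem exists_uniform_cone {D : Set E} (hc : IsCompact (closure D))
    (h : ∀ x ∈ closure D, LocalCone D x) :
    ∃ lam τ θ L : ℝ, 0 < lam ∧ 0 < τ ∧ 0 < θ ∧ 0 < L ∧ ∀ x ∈ closure D, ∃ n : E, ‖n‖ ≤ L ∧
      ∀ y ∈ D, dist y x < lam → ∀ s, 0 < s → s ≤ τ → Metric.ball (y + s • n) (θ * s) ⊆ D := by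
  choose! n ε τ θ hε hτ hθ hcone using h
  obtain ⟨t, htD, ht⟩ := hc.elim_nhds_subcover (fun x => Metric.ball x (ε x))
    (fun x hx => Metric.ball_mem_nhds x (hε x hx))
  obtain ⟨lam, hlam, hleb⟩ := lebesgue_number_lemma_of_metric (ι := t) hc
    (c := fun x => Metric.ball x.1 (ε x.1)) (fun _ => Metric.isOpen_ball)
    (by simpa [Set.iUnion_subtype] using ht)
  have hmin : ∀ f : E → ℝ, (∀ x ∈ closure D, 0 < f x) → ∃ m : ℝ, 0 < m ∧ ∀ x ∈ t, m ≤ f x := by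
    intro f hf
    rcases t.eq_empty_or_nonempty with rfl | hne
    · exact ⟨1, one_pos, by simp⟩
    · obtain ⟨x, hx, hxm⟩ := t.exists_min_image f hne
      exact ⟨f x, hf x (htD x hx), hxm⟩
  obtain ⟨τ', hτ', hτle⟩ := hmin τ hτ
  obtain ⟨θ', hθ', hθle⟩ := hmin θ hθ
  refine ⟨lam, τ', θ', ∑ x ∈ t, ‖n x‖ + 1, hlam, hτ', hθ', by positivity, ?_⟩
  intro x hx
  obtain ⟨⟨p, hp⟩, hsub⟩ := hleb x hx
  refine ⟨n p, ?_, ?_⟩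
  · have := Finset.single_le_sum (f := fun x => ‖n x‖) (fun i _ => norm_nonneg _) hp
    beta_reduce at this
    linarith
  · intro y hy hyx s hs hsτ
    refine (Metric.ball_subset_ball ?_).trans
      (hcone p (htD p hp) y hy (Metric.mem_ball.1 (hsub hyx)) s hs (hsτ.trans (hτle p hp)))
    have := hθle p hp
    gcongr

end ConeProperty

namespace Geometry

variable {d : ℕ} (G : Geometry d)

theorem isOpen_domain : IsOpen G.Ω := by
  obtain ⟨S, hS⟩ := G.polygonal
  rw [hS]
  exact isOpen_interior

theorem convex_domain : Convex ℝ G.Ω := by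
  obtain ⟨S, hS⟩ := G.polygonal
  rw [hS]
  exact (convex_convexHull ℝ _).interior

theorem isBounded_domain : Bornology.IsBounded G.Ω := by
  obtain ⟨S, hS⟩ := G.polygonal
  rw [hS]
  exact (S.finite_toSet.isCompact_convexHull (𝕜 := ℝ)).isBounded.subset interior_subset

theorem isOpen_bulk (i : Fin 2) : IsOpen (G.bulk i) := by
  unfold bulk
  split_ifs
  exacts [G.isOpen₁, G.isOpen₂]

theorem isConnected_bulk (i : Fin 2) : IsConnected (G.bulk i) := by
  unfold bulk
  split_ifs
  exacts [G.connected₁, G.connected₂]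

theorem bulk_subset (i : Fin 2) : G.bulk i ⊆ G.Ω := by
  unfold bulk
  rw [G.partition]
  split_ifs
  · exact fun x hx => Or.inl (Or.inl hx)
  · exact fun x hx => Or.inr hx

theorem exists_other_bulk (i : Fin 2) : ∃ D' : Set (Space d), IsOpen D' ∧ Disjoint (G.bulk i) D' ∧
    ∀ x ∈ G.Ω, x ∈ G.bulk i ∨ x ∈ G.Ω₀ ∨ x ∈ D' := by
  have hp := G.partition
  unfold bulk
  split_ifs
  · refine ⟨G.Ω₂, G.isOpen₂, G.disjoint₁₂, fun x hx => ?_⟩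
    rw [hp] at hx
    rcases hx with (h | h) | h <;> tauto
  · refine ⟨G.Ω₁, G.isOpen₁, G.disjoint₁₂.symm, fun x hx => ?_⟩
    rw [hp] at hx
    rcases hx with (h | h) | h <;> tauto

theorem localCone_of_mem_interface (i : Fin 2) {x : Space d} (hx : x ∈ G.Ω₀) :
    LocalCone (G.bulk i) x := by
  obtain ⟨U, φ, hU, hxU, -, hφ, hφ', hside⟩ := G.smooth_interface x hx
  have hstrict : HasStrictFDerivAt φ (fderiv ℝ φ x) x :=
    (hφ.contDiffAt (hU.mem_nhds hxU)).hasStrictFDerivAt (by simp)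
  have hUn := hU.mem_nhds hxU
  unfold bulk
  split_ifs
  · exact localCone_of_hasStrictFDerivAt hstrict (hφ' x hxU)
      (Filter.mem_of_superset hUn fun y hy => (hside y hy).2.1)
  · refine localCone_of_hasStrictFDerivAt hstrict.neg (neg_ne_zero.2 (hφ' x hxU))
      (Filter.mem_of_superset hUn fun y hy => ?_)
    have := (hside y hy).2.2
    simpa using this

/-- Near the boundary of `Ω` there is no interface, so that there `Ω` belongs to only one of the two
bulk domains, and the cone property follows from the convexity of `Ω`. -/
theorem localCone_of_mem_frontier (i : Fin 2) {x : Space d} (hx : x ∉ G.Ω)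
    (hxc : x ∈ closure (G.bulk i)) : LocalCone (G.bulk i) x := by
  obtain ⟨D', hD'o, hdisj, hcov⟩ := G.exists_other_bulk i
  have hx0 : x ∈ G.Ω₀ᶜ := fun h => hx (by rw [G.partition]; exact Or.inl (Or.inr h))
  obtain ⟨δ, hδ, hb⟩ := Metric.isOpen_iff.1 G.compact_interface.isClosed.isOpen_compl x hx0
  refine localCone_of_convex G.convex_domain (by rw [G.isOpen_domain.interior_eq]; exact G.nonempty)
    hδ fun y hy => ⟨fun h => G.bulk_subset i h, fun h => ?_⟩
  have hpre : IsPreconnected (Metric.ball x δ ∩ G.Ω) :=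
    ((convex_ball x δ).inter G.convex_domain).isPreconnected
  obtain ⟨w, hwb, hwD⟩ := mem_closure_iff.1 hxc _ Metric.isOpen_ball (Metric.mem_ball_self hδ)
  have hcov' : Metric.ball x δ ∩ G.Ω ⊆ G.bulk i ∪ D' := fun z hz => by
    rcases hcov z hz.2 with h | h | h
    · exact Or.inl h
    · exact absurd h (hb hz.1)
    · exact Or.inr h
  exact hpre.subset_left_of_subset_union (G.isOpen_bulk i) hD'o hdisj hcov'
    ⟨w, ⟨hwb, G.bulk_subset i hwD⟩, hwD⟩ ⟨hy, h⟩

theorem localCone_bulk (i : Fin 2) {x : Space d} (hx : x ∈ closure (G.bulk i)) :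
    LocalCone (G.bulk i) x := by
  by_cases hxΩ : x ∈ G.Ω
  · obtain ⟨D', hD'o, hdisj, hcov⟩ := G.exists_other_bulk i
    rcases hcov x hxΩ with h | h | h
    · exact localCone_of_isOpen (G.isOpen_bulk i) h
    · exact G.localCone_of_mem_interface i h
    · exact absurd h (Set.disjoint_left.1 (hdisj.closure_left hD'o) hx)
  · exact G.localCone_of_mem_frontier i hxΩ hx

end Geometry

/-! ### Corridors -/

section Corridor

variable {d : ℕ}

theorem volume_real_closedBall (z : Space d) {r : ℝ} (hr : 0 ≤ r) :
    volume.real (Metric.closedBall z r) =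
      r ^ d * volume.real (Metric.closedBall (0 : Space d) 1) := by
  rw [Measure.addHaar_real_closedBall' volume z hr, finrank_euclideanSpace_fin]

theorem volume_real_unitBall_pos : 0 < volume.real (Metric.closedBall (0 : Space d) 1) :=
  ENNReal.toReal_pos (Metric.measure_closedBall_pos volume _ one_pos).ne'
    measure_closedBall_lt_top.ne

/-- A convex set containing a ball of radius `ρ` moves by a vector of length at most `ε ρ` inside
its dilation by the factor `1 + ε`. -/
theorem add_mem_homothety {K : Set (Space d)} (hK : Convex ℝ K) {x₀ : Space d} {ρ ε : ℝ}
    (hball : Metric.closedBall x₀ ρ ⊆ K) (hε : 0 ≤ ε) {e : Space d}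
    (he : ‖e‖ ≤ ε * ρ) {y : Space d} (hy : y ∈ K) :
    y + e ∈ AffineMap.homothety x₀ (1 + ε) '' K := by
  rcases hε.eq_or_lt with rfl | hε'
  · have : e = 0 := by simpa using he
    exact ⟨y, hy, by simp [this]⟩
  have h1 : x₀ + ε⁻¹ • e ∈ K := by
    apply hball
    rw [Metric.mem_closedBall, dist_eq_norm, add_sub_cancel_left, norm_smul,
      Real.norm_of_nonneg (by positivity), inv_mul_le_iff₀ hε']
    exact he
  have h2 := hK hy h1 (a := 1 / (1 + ε)) (b := ε / (1 + ε)) (by positivity) (by positivity)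
    (by field_simp)
  refine ⟨_, h2, ?_⟩
  have h3 : (1 + ε) * (1 / (1 + ε)) = 1 := by field_simp
  have h4 : (1 + ε) * (ε / (1 + ε)) = ε := by field_simp
  rw [AffineMap.homothety_apply, vsub_eq_sub, vadd_eq_add, smul_sub, smul_add, smul_smul, h3,
    one_smul, smul_smul, h4, smul_add, smul_smul, mul_inv_cancel₀ hε'.ne', one_smul]
  module

/-- A part of `K` whose volume exceeds that of the layer between `K` and its dilation by `1 + ε`
contains a point which remains in `K` under a translation of length at most `ε ρ`. -/
theorem exists_translate_mem {K A : Set (Space d)} (hK : Convex ℝ K) (hKc : IsClosed K) (hA : A ⊆ K)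
    {x₀ z : Space d} {ρ ε r : ℝ}
    (hball : Metric.closedBall x₀ ρ ⊆ K) (hKr : K ⊆ Metric.closedBall z r) (hε : 0 ≤ ε)
    (hρ : 0 ≤ ρ) {e : Space d} (he : ‖e‖ ≤ ε * ρ)
    (hvol : ((1 + ε) ^ d - 1) * volume.real (Metric.closedBall z r) < volume.real A) :
    ∃ y ∈ A, y + e ∈ K := by
  -- Otherwise `A + e` and `K` are disjoint subsets of the dilation of `K`.
  by_contra! hcon
  have hKfin : volume K ≠ ⊤ := ((measure_mono hKr).trans_lt measure_closedBall_lt_top).ne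
  have hdil : volume.real (AffineMap.homothety x₀ (1 + ε) '' K) = (1 + ε) ^ d * volume.real K := by
    rw [measureReal_def, Measure.addHaar_image_homothety, finrank_euclideanSpace_fin,
      ENNReal.toReal_mul, ENNReal.toReal_ofReal (abs_nonneg _), abs_of_nonneg (by positivity)]
    rfl
  have hdilfin : volume (AffineMap.homothety x₀ (1 + ε) '' K) ≠ ⊤ := by
    rw [Measure.addHaar_image_homothety]
    exact ENNReal.mul_ne_top ENNReal.ofReal_ne_top hKfin
  have hdisj : Disjoint ((fun y => y + e) '' A) K := by
    rw [Set.disjoint_left]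
    rintro _ ⟨y, hy, rfl⟩ hyK
    exact hcon y hy hyK
  have hsub : (fun y => y + e) '' A ∪ K ⊆ AffineMap.homothety x₀ (1 + ε) '' K := by
    rintro w (⟨y, hy, rfl⟩ | hw)
    · exact add_mem_homothety hK hball hε he (hA hy)
    · simpa using add_mem_homothety hK hball hε (e := 0) (by simpa using by positivity) hw
  have hshift : volume.real ((fun y => y + e) '' A) = volume.real A := by
    simp [measureReal_def]
  have h1 := measureReal_mono hsub hdilfin
  rw [measureReal_union hdisj hKc.measurableSet
    (by simpa using ((measure_mono hA).trans_lt hKfin.lt_top).ne) hKfin, hshift, hdil] at h1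
  have h2 := measureReal_mono hKr (μ := volume) measure_closedBall_lt_top.ne
  have h3 : 0 ≤ (1 + ε) ^ d - 1 := sub_nonneg.2 (one_le_pow₀ (by linarith))
  nlinarith

/-- `U` is a corridor of width `r` in `D` between `K` and `K'`: it is open and connected, stays at
distance at least `r` from the complement of `D`, and meets both `K` and `K'`. -/
structure IsCorridor (D U K K' : Set (Space d)) (r : ℝ) : Prop where
  isOpen : IsOpen U
  isPreconnected : IsPreconnected U
  left : (U ∩ K).Nonempty
  right : (U ∩ K').Nonempty
  ball_subset : ∀ x ∈ U, Metric.ball x r ⊆ D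

/-- Any two convex bodies of diameter comparable to `h`, at distance at most of order `h` and with a
part of `D` of volume at least `γ h^d` in each of them, are joined by a corridor of
width `c h` in a ball of radius `R h`. -/
def HasCorridors (D : Set (Space d)) (C₀ ρ₀ γ h R c : ℝ) : Prop :=
  ∀ (z : Space d) (K K' : Set (Space d)), Convex ℝ K → Convex ℝ K' → IsClosed K → IsClosed K' →
    K ⊆ Metric.closedBall z (C₀ * h) → K' ⊆ Metric.closedBall z (C₀ * h) →
    (∃ x, Metric.closedBall x (ρ₀ * h) ⊆ K) → (∃ x, Metric.closedBall x (ρ₀ * h) ⊆ K') →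
    γ * h ^ d ≤ volume.real (K ∩ D) → γ * h ^ d ≤ volume.real (K' ∩ D) →
    ∃ U, U ⊆ Metric.closedBall z (R * h) ∧ IsCorridor D U K K' (c * h)

theorem HasCorridors.mono {D : Set (Space d)} {C₀ ρ₀ γ h R c R' c' : ℝ} (hh : 0 < h)
    (H : HasCorridors D C₀ ρ₀ γ h R c) (hR : R ≤ R') (hc : c' ≤ c) :
    HasCorridors D C₀ ρ₀ γ h R' c' := by
  intro z K K' h1 h2 h3 h4 h5 h6 h7 h8 h9 h10
  obtain ⟨U, hU, hUc⟩ := H z K K' h1 h2 h3 h4 h5 h6 h7 h8 h9 h10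
  exact ⟨U, hU.trans (Metric.closedBall_subset_closedBall (by gcongr)),
    ⟨hUc.isOpen, hUc.isPreconnected, hUc.left, hUc.right, fun x hx =>
      (Metric.ball_subset_ball (by gcongr)).trans (hUc.ball_subset x hx)⟩⟩

/-- The union of the two thickened axes of cones with parallel axes over `y` and `y'` and of a ball
around an end point is a corridor. -/
theorem isCorridor_of_cones {D K K' : Set (Space d)} {y y' n : Space d} {s t θ : ℝ} (ht : 0 < t)
    (hts : t ≤ s) (hθ : 0 < θ)
    (hy : ∀ u, t ≤ u → u ≤ s → Metric.ball (y + u • n) (θ * u) ⊆ D)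
    (hy' : ∀ u, t ≤ u → u ≤ s → Metric.ball (y' + u • n) (θ * u) ⊆ D)
    (hK : y + t • n ∈ K) (hK' : y' + t • n ∈ K') (hyy' : dist y' y < θ * s / 2)
    {z : Space d} {C : ℝ} (hyz : dist y z ≤ C) (hyz' : dist y' z ≤ C) :
    ∃ U, U ⊆ Metric.closedBall z (C + s * (‖n‖ + θ)) ∧ IsCorridor D U K K' (θ * t / 2) := by
  have hs : 0 < s := ht.trans_le hts
  set I : Space d → Set (Space d) := fun p => segment ℝ (p + t • n) (p + s • n) with hI
  have hmem : ∀ p, ∀ x ∈ I p, ∃ u, t ≤ u ∧ u ≤ s ∧ x = p + u • n := by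
    rintro p x ⟨a, b, ha, hb, hab, rfl⟩
    refine ⟨a * t + b * s, ?_, ?_, ?_⟩
    · nlinarith
    · nlinarith
    · have hp : p = a • p + b • p := by rw [← add_smul, hab, one_smul]
      conv_rhs => rw [hp]
      module
  set A : Space d → Set (Space d) := fun p => Metric.thickening (θ * t / 2) (I p) with hA
  have hAsub : ∀ p, (∀ u, t ≤ u → u ≤ s → Metric.ball (p + u • n) (θ * u) ⊆ D) →
      ∀ x ∈ A p, Metric.ball x (θ * t / 2) ⊆ D := by
    intro p hp x hx w hw
    obtain ⟨q, hq, hxq⟩ := Metric.mem_thickening_iff.1 hx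
    obtain ⟨u, hu1, hu2, rfl⟩ := hmem p q hq
    refine hp u hu1 hu2 ?_
    have h1 := dist_triangle w x (p + u • n)
    have h2 := Metric.mem_ball.1 hw
    have h3 : θ * t ≤ θ * u := by gcongr
    rw [Metric.mem_ball]
    linarith
  have hAz : ∀ p, dist p z ≤ C → A p ⊆ Metric.closedBall z (C + s * (‖n‖ + θ)) := by
    intro p hp x hx
    obtain ⟨q, hq, hxq⟩ := Metric.mem_thickening_iff.1 hx
    obtain ⟨u, hu1, hu2, rfl⟩ := hmem p q hq
    have h1 : dist x z ≤ dist x (p + u • n) + dist (p + u • n) p + dist p z :=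
      dist_triangle4 _ _ _ _
    have h2 : dist (p + u • n) p = u * ‖n‖ := by
      simp [dist_eq_norm, norm_smul, abs_of_pos (ht.trans_le hu1)]
    have h3 : u * ‖n‖ ≤ s * ‖n‖ := by gcongr
    have h4 : θ * t ≤ θ * s := by gcongr
    have h5 : 0 < θ * t := by positivity
    rw [Metric.mem_closedBall]
    nlinarith
  have hAo : ∀ p, IsOpen (A p) := fun p => Metric.isOpen_thickening
  have hAp : ∀ p, IsPreconnected (A p) := fun p =>
    ((convex_segment _ _).thickening _).isPreconnected
  have hAl : ∀ p, p + t • n ∈ A p := fun p =>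
    Metric.self_subset_thickening (by positivity) _ (left_mem_segment ℝ _ _)
  have hAr : ∀ p, p + s • n ∈ A p := fun p =>
    Metric.self_subset_thickening (by positivity) _ (right_mem_segment ℝ _ _)
  set B := Metric.ball (y + s • n) (θ * s / 2) with hB
  have hBl : y + s • n ∈ B := Metric.mem_ball_self (by positivity)
  have hBr : y' + s • n ∈ B := by
    rw [hB, Metric.mem_ball, dist_add_right]
    exact hyy'
  refine ⟨A y ∪ B ∪ A y', ?_, ⟨((hAo y).union Metric.isOpen_ball).union (hAo y'), ?_,
    ⟨_, Or.inl (Or.inl (hAl y)), hK⟩, ⟨_, Or.inr (hAl y'), hK'⟩, ?_⟩⟩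
  · rintro x ((hx | hx) | hx)
    · exact hAz y hyz hx
    · have h2 := Metric.mem_ball.1 hx
      have h3 : dist x z ≤ dist x (y + s • n) + dist (y + s • n) y + dist y z :=
        dist_triangle4 _ _ _ _
      have h4 : dist (y + s • n) y = s * ‖n‖ := by
        simp [dist_eq_norm, norm_smul, abs_of_pos hs]
      have h5 : 0 < θ * s := by positivity
      rw [Metric.mem_closedBall]
      nlinarith
    · exact hAz y' hyz' hx
  · refine ((hAp y).union _ (hAr y) hBl (convex_ball _ _).isPreconnected).union _ (Or.inr hBr)
      (hAr y') (hAp y')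
  · rintro x ((hx | hx) | hx)
    · exact hAsub y hy x hx
    · intro w hw
      refine hy s hts le_rfl ?_
      have h1 := dist_triangle w x (y + s • n)
      have h2 := Metric.mem_ball.1 hw
      have h3 := Metric.mem_ball.1 hx
      have h4 : θ * t ≤ θ * s := by gcongr
      rw [Metric.mem_ball]
      linarith
    · exact hAsub y' hy' x hx

theorem exists_corridors_small {D : Set (Space d)} (hc : IsCompact (closure D))
    (hD : ∀ x ∈ closure D, LocalCone D x) {C₀ ρ₀ γ : ℝ} (hC₀ : 0 < C₀) (hρ₀ : 0 < ρ₀)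
    (hγ : 0 < γ) :
    ∃ h₁ R c : ℝ, 0 < h₁ ∧ 0 < R ∧ 0 < c ∧ ∀ h, 0 < h → h ≤ h₁ →
      HasCorridors D C₀ ρ₀ γ h R c := by
  obtain ⟨lam, τ, θ, L, hlam, hτ, hθ, hL, hcone⟩ := exists_uniform_cone hc hD
  -- `ε` is such that the layer in `exists_translate_mem` is smaller than `γ h^d`.
  obtain ⟨ε, hε, hεγ⟩ : ∃ ε : ℝ, 0 < ε ∧
      ((1 + ε) ^ d - 1) * (C₀ ^ d * volume.real (Metric.closedBall (0 : Space d) 1)) < γ := by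
    have hcont : Filter.Tendsto (fun ε : ℝ => ((1 + ε) ^ d - 1) *
        (C₀ ^ d * volume.real (Metric.closedBall (0 : Space d) 1))) (nhdsWithin 0 (Set.Ioi 0))
        (nhds (((1 + 0) ^ d - 1) *
          (C₀ ^ d * volume.real (Metric.closedBall (0 : Space d) 1)))) :=
      tendsto_nhdsWithin_of_tendsto_nhds (Continuous.tendsto (by fun_prop) 0)
    simp only [add_zero, one_pow, sub_self, zero_mul] at hcont
    obtain ⟨ε, h1, h2⟩ := ((hcont.eventually (gt_mem_nhds hγ)).and self_mem_nhdsWithin).exists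
    exact ⟨ε, h2, h1⟩
  set c₂ : ℝ := ε * ρ₀ / L with hc₂
  have hc₂0 : 0 < c₂ := by positivity
  set lamb : ℝ := c₂ + 4 * C₀ / θ + 1 with hlamb
  have hlamb0 : 0 < lamb := by positivity
  refine ⟨min (τ / lamb) (lam / (4 * C₀)), C₀ + lamb * (L + θ), θ * c₂ / 2, by positivity,
    by positivity, by positivity, ?_⟩
  intro h hh hh1 z K K' hK hK' hKc hKc' hKz hKz' ⟨x₀, hx₀⟩ ⟨x₀', hx₀'⟩ hvol hvol'
  have hhτ := (le_div_iff₀ hlamb0).1 (hh1.trans (min_le_left _ _))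
  have hhlam := (le_div_iff₀ (by positivity)).1 (hh1.trans (min_le_right _ _))
  have hne : (K ∩ D).Nonempty := by
    rw [Set.nonempty_iff_ne_empty]
    intro h0
    rw [h0, measureReal_empty] at hvol
    have : 0 < γ * h ^ d := by positivity
    linarith
  obtain ⟨x, hxK, hxD⟩ := hne
  obtain ⟨n, hnL, hn⟩ := hcone x (subset_closure hxD)
  have he : ‖(c₂ * h) • n‖ ≤ ε * (ρ₀ * h) := by
    rw [norm_smul, Real.norm_of_nonneg (by positivity)]
    calc c₂ * h * ‖n‖ ≤ c₂ * h * L := by gcongr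
      _ = ε * (ρ₀ * h) := by rw [hc₂]; field_simp
  have hlayer : ((1 + ε) ^ d - 1) * volume.real (Metric.closedBall z (C₀ * h)) < γ * h ^ d := by
    rw [volume_real_closedBall z (by positivity), mul_pow]
    calc ((1 + ε) ^ d - 1) * (C₀ ^ d * h ^ d * volume.real (Metric.closedBall (0 : Space d) 1))
        = ((1 + ε) ^ d - 1) * (C₀ ^ d * volume.real (Metric.closedBall (0 : Space d) 1)) *
          h ^ d := by ring
      _ < γ * h ^ d := by gcongr
  obtain ⟨y, ⟨hyK, hyD⟩, hye⟩ := exists_translate_mem hK hKc Set.inter_subset_left hx₀ hKz hε.le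
    (by positivity) he (hlayer.trans_le hvol)
  obtain ⟨y', ⟨hyK', hyD'⟩, hye'⟩ := exists_translate_mem hK' hKc' Set.inter_subset_left hx₀' hKz'
    hε.le (by positivity) he (hlayer.trans_le hvol')
  have hdx := Metric.mem_closedBall.1 (hKz hxK)
  have hdy := Metric.mem_closedBall.1 (hKz hyK)
  have hdy' := Metric.mem_closedBall.1 (hKz' hyK')
  have hnear : ∀ p, dist p z ≤ C₀ * h → dist p x < lam := by
    intro p hp
    have := dist_triangle_right p x z
    have : 0 < C₀ * h := by positivity
    linarith
  have hcone' : ∀ p ∈ D, dist p z ≤ C₀ * h → ∀ u, c₂ * h ≤ u → u ≤ lamb * h →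
      Metric.ball (p + u • n) (θ * u) ⊆ D := by
    intro p hpD hp u hu1 hu2
    have : 0 < c₂ * h := by positivity
    exact hn p hpD (hnear p hp) u (by linarith) (by linarith)
  obtain ⟨U, hU, hUc⟩ := isCorridor_of_cones (s := lamb * h) (t := c₂ * h) (by positivity)
    (by gcongr; rw [hlamb]; have : 0 < 4 * C₀ / θ := by positivity
        linarith) hθ
    (hcone' y hyD hdy) (hcone' y' hyD' hdy') hye hye' (by
      have h1 := dist_triangle_right y' y z
      have h2 : θ * (lamb * h) / 2 = θ * (c₂ + 1) * h / 2 + 2 * (C₀ * h) := by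
        rw [hlamb]
        field_simp
        ring
      have h3 : 0 < θ * (c₂ + 1) * h := by positivity
      linarith) hdy hdy'
  refine ⟨U, hU.trans (Metric.closedBall_subset_closedBall ?_), ?_⟩
  · have : lamb * h * (‖n‖ + θ) ≤ lamb * h * (L + θ) := by gcongr
    linarith
  · convert hUc using 1
    ring

/-- A bounded connected open set is exhausted, up to a set of small volume, by an open connected
set at positive distance from the complement. -/
theorem exists_preconnected_core {D : Set (Space d)} (hDo : IsOpen D) (hDc : IsConnected D)
    (hDb : Bornology.IsBounded D) {η : ℝ} (hη : 0 < η) :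
    ∃ (U : Set (Space d)) (r : ℝ), 0 < r ∧ IsOpen U ∧ IsPreconnected U ∧ U ⊆ D ∧
      (∀ x ∈ U, Metric.ball x r ⊆ D) ∧ volume.real (D \ U) < η := by
  obtain ⟨p₀, hp₀⟩ := hDc.nonempty
  set V : ℕ → Set (Space d) := fun n => {x | ((n : ENNReal) + 1)⁻¹ < Metric.infEDist x Dᶜ} with hV
  have hVo : ∀ n, IsOpen (V n) := fun n =>
    isOpen_lt continuous_const Metric.continuous_infEDist
  have hVmono : Monotone V := by
    intro m n hmn x hx
    refine lt_of_le_of_lt ?_ (show ((m : ENNReal) + 1)⁻¹ < Metric.infEDist x Dᶜ from hx)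
    gcongr
  have hVD : ∀ n, V n ⊆ D := by
    intro n x hx
    by_contra hxD
    have : Metric.infEDist x Dᶜ = 0 := Metric.infEDist_zero_of_mem hxD
    simp [hV, this] at hx
  have hVcov : D ⊆ ⋃ n, V n := by
    intro x hx
    have hpos : Metric.infEDist x Dᶜ ≠ 0 := by
      intro h0
      have := (Metric.mem_closure_iff_infEDist_zero (s := Dᶜ)).2 h0
      rw [hDo.isClosed_compl.closure_eq] at this
      exact this hx
    obtain ⟨n, hn⟩ := ENNReal.exists_inv_nat_lt hpos
    refine Set.mem_iUnion.2 ⟨n, lt_of_le_of_lt ?_ hn⟩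
    gcongr
    exact le_self_add
  -- Every point of `D` lies on a path from `p₀`, which is compact and thus contained in some `V n`,
  -- so that the components of `p₀` in the sets `V n` exhaust `D`.
  set W : ℕ → Set (Space d) := fun n => connectedComponentIn (V n) p₀ with hW
  have hWo : ∀ n, IsOpen (W n) := fun n => (hVo n).connectedComponentIn
  have hWmono : Monotone W := fun m n hmn => connectedComponentIn_mono _ (hVmono hmn)
  have hWV : ∀ n, W n ⊆ V n := fun n => connectedComponentIn_subset _ _
  have hWcov : D ⊆ ⋃ n, W n := by
    intro x hx
    have hpath : IsPathConnected D := (hDo.isConnected_iff_isPathConnected).1 hDc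
    obtain ⟨g, hg⟩ := hpath.joinedIn p₀ hp₀ x hx
    have hcomp : IsCompact (Set.range g) := isCompact_range g.continuous
    obtain ⟨n, hn⟩ := hcomp.elim_directed_cover V hVo
      ((Set.range_subset_iff.2 hg).trans hVcov) hVmono.directed_le
    have hsub : Set.range g ⊆ W n :=
      (isPreconnected_range g.continuous).subset_connectedComponentIn ⟨0, g.source⟩ hn
    exact Set.mem_iUnion.2 ⟨n, hsub ⟨1, g.target⟩⟩
  have hDfin : volume D ≠ ⊤ := hDb.measure_lt_top.ne
  have hlim : Filter.Tendsto (fun n => volume (D \ W n)) Filter.atTop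
      (nhds (volume (⋂ n, D \ W n))) :=
    tendsto_measure_iInter_atTop
      (fun n => (hDo.measurableSet.diff (hWo n).measurableSet).nullMeasurableSet)
      (fun m n hmn => Set.sdiff_subset_sdiff_right (hWmono hmn))
      ⟨0, ((measure_mono Set.sdiff_subset).trans_lt hDfin.lt_top).ne⟩
  have hempty : ⋂ n, D \ W n = ∅ := by
    rw [← Set.sdiff_iUnion]
    exact Set.sdiff_eq_empty.2 hWcov
  rw [hempty, measure_empty] at hlim
  obtain ⟨n, hn⟩ := (hlim.eventually (gt_mem_nhds (ENNReal.ofReal_pos.2 hη))).exists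
  refine ⟨W n, ((n : ℝ) + 1)⁻¹, by positivity, hWo n, isPreconnected_connectedComponentIn,
    (hWV n).trans (hVD n), ?_, ?_⟩
  · intro x hx w hw
    by_contra hwD
    have h1 : ((n : ENNReal) + 1)⁻¹ < Metric.infEDist x Dᶜ := hWV n hx
    have h2 : Metric.infEDist x Dᶜ ≤ edist x w := Metric.infEDist_le_edist_of_mem hwD
    have h3 : edist x w < ((n : ENNReal) + 1)⁻¹ := by
      rw [edist_dist, dist_comm]
      have h4 := (ENNReal.ofReal_lt_ofReal_iff (by positivity)).2 (Metric.mem_ball.1 hw)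
      rw [ENNReal.ofReal_inv_of_pos (by positivity), ENNReal.ofReal_add (by positivity) zero_le_one,
        ENNReal.ofReal_natCast, ENNReal.ofReal_one] at h4
      exact h4
    exact absurd (h1.trans_le h2) (not_lt.2 h3.le)
  · exact (ENNReal.toReal_lt_toReal (hn.trans ENNReal.ofReal_lt_top).ne ENNReal.ofReal_ne_top).2 hn
      |>.trans_eq (ENNReal.toReal_ofReal hη.le)

theorem exists_corridors_large {D : Set (Space d)} (hDo : IsOpen D) (hDc : IsConnected D)
    (hDb : Bornology.IsBounded D) {C₀ ρ₀ γ h₀ h₁ : ℝ} (hC₀ : 0 < C₀) (hγ : 0 < γ) (hh₀ : 0 < h₀)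
    (hh₁ : 0 < h₁) :
    ∃ R c : ℝ, 0 < R ∧ 0 < c ∧ ∀ h, h₁ ≤ h → h ≤ h₀ → HasCorridors D C₀ ρ₀ γ h R c := by
  obtain ⟨U, r, hr, hUo, hUp, hUD, hUr, hUη⟩ := exists_preconnected_core hDo hDc hDb
    (show 0 < γ * h₁ ^ d by positivity)
  have hDfin : volume D ≠ ⊤ := hDb.measure_lt_top.ne
  set m := Metric.diam D
  have hm : 0 ≤ m := Metric.diam_nonneg
  refine ⟨m / h₁ + C₀, r / h₀, by positivity, by positivity, ?_⟩
  intro h hh1 hh0 z K K' hK hK' hKc hKc' hKz hKz' _ _ hvol hvol'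
  have hh : 0 < h := hh₁.trans_le hh1
  have hmeet : ∀ A : Set (Space d), γ * h ^ d ≤ volume.real (A ∩ D) → (U ∩ A).Nonempty := by
    intro A hA
    by_contra hne
    rw [Set.not_nonempty_iff_eq_empty] at hne
    have hsub : A ∩ D ⊆ D \ U := fun x hx => ⟨hx.2, fun hxU => by
      have : x ∈ U ∩ A := ⟨hxU, hx.1⟩
      rw [hne] at this
      exact this⟩
    have h1 := measureReal_mono hsub ((measure_mono Set.sdiff_subset).trans_lt hDfin.lt_top).ne
    have h2 : γ * h₁ ^ d ≤ γ * h ^ d := by gcongr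
    linarith
  refine ⟨U, ?_, ⟨hUo, hUp, hmeet K hvol, hmeet K' hvol', fun x hx => ?_⟩⟩
  · obtain ⟨p, hpU, hpK⟩ := hmeet K hvol
    intro x hx
    have h1 := Metric.dist_le_diam_of_mem hDb (hUD hx) (hUD hpU)
    have h2 := Metric.mem_closedBall.1 (hKz hpK)
    have h3 := dist_triangle x p z
    have h4 : m ≤ m / h₁ * h := by
      rw [div_mul_eq_mul_div, le_div_iff₀ hh₁]
      gcongr
    rw [Metric.mem_closedBall]
    linarith
  · refine (Metric.ball_subset_ball ?_).trans (hUr x hx)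
    rw [div_mul_eq_mul_div, div_le_iff₀ hh₀]
    gcongr

/-- Corridors exist with uniform constants: for small `h` by the cone property, for `h` bounded from
below by the connectedness of `D`. -/
theorem exists_corridors {D : Set (Space d)} (hDo : IsOpen D) (hDc : IsConnected D)
    (hDb : Bornology.IsBounded D) (hD : ∀ x ∈ closure D, LocalCone D x) {C₀ ρ₀ γ h₀ : ℝ}
    (hC₀ : 0 < C₀) (hρ₀ : 0 < ρ₀) (hγ : 0 < γ) (hh₀ : 0 < h₀) :
    ∃ R c : ℝ, 0 < R ∧ 0 < c ∧ ∀ h, 0 < h → h ≤ h₀ → HasCorridors D C₀ ρ₀ γ h R c := by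
  obtain ⟨h₁, R₁, c₁, hh₁, hR₁, hc₁, H₁⟩ :=
    exists_corridors_small hDb.isCompact_closure hD hC₀ hρ₀ hγ
  obtain ⟨R₂, c₂, hR₂, hc₂, H₂⟩ :=
    exists_corridors_large (ρ₀ := ρ₀) hDo hDc hDb hC₀ hγ hh₀ hh₁
  refine ⟨max R₁ R₂, min c₁ c₂, by positivity, by positivity, fun h hh hhh => ?_⟩
  rcases le_total h h₁ with hle | hle
  · exact (H₁ h hh hle).mono hh (le_max_left _ _) (min_le_left _ _)
  · exact (H₂ h hle hhh).mono hh (le_max_right _ _) (min_le_right _ _)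

end Corridor

/-! ### Elements met by a connected open set -/

section Simplices

variable {d : ℕ}

theorem isCompact_simplex (s : Finset (Space d)) : IsCompact (simplex s) :=
  s.finite_toSet.isCompact_convexHull (𝕜 := ℝ)

theorem convex_simplex (s : Finset (Space d)) : Convex ℝ (simplex s) := convex_convexHull ℝ _

theorem simplex_mono {s t : Finset (Space d)} (h : s ⊆ t) : simplex s ⊆ simplex t :=
  convexHull_mono (by exact_mod_cast h)

theorem simplex_subset_affineSpan (s : Finset (Space d)) :
    simplex s ⊆ (affineSpan ℝ (s : Set (Space d)) : Set (Space d)) :=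
  convexHull_subset_affineSpan _

theorem dist_le_size {T : Finset (Space d)} {x y : Space d} (hx : x ∈ simplex T)
    (hy : y ∈ simplex T) : dist x y ≤ Mesh.size T :=
  Metric.dist_le_diam_of_mem (isCompact_simplex T).isBounded hx hy

theorem affineSpan_ne_top_of_card_le {s : Finset (Space d)} (hs : s.card ≤ d) :
    affineSpan ℝ (s : Set (Space d)) ≠ ⊤ := by
  intro htop
  rcases s.eq_empty_or_nonempty with rfl | hne
  · simp at htop
  obtain ⟨n, hn⟩ := Nat.exists_eq_add_of_lt hne.card_pos
  have h1 := finrank_vectorSpan_image_finset_le ℝ (id : Space d → Space d) s (n := n) (by omega)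
  rw [Finset.image_id, ← direction_affineSpan, htop, AffineSubspace.direction_top, finrank_top,
    finrank_euclideanSpace_fin] at h1
  omega

theorem volume_affineSpan_eq_zero {s : Finset (Space d)} (hs : s.card ≤ d) :
    volume (affineSpan ℝ (s : Set (Space d)) : Set (Space d)) = 0 :=
  Measure.addHaar_affineSubspace _ _ (affineSpan_ne_top_of_card_le hs)

end Simplices

namespace Mesh

variable {d : ℕ} {Ω : Set (Space d)} (𝒯 : Mesh Ω)

theorem mem_elements {T : Finset (Space d)} :
    T ∈ 𝒯.elements ↔ T ∈ 𝒯.complex.faces ∧ T.card = d + 1 := by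
  simp [elements]

variable {𝒯}

theorem simplex_inter {T T' : Finset (Space d)} (hT : T ∈ 𝒯.elements) (hT' : T' ∈ 𝒯.elements) :
    simplex T ∩ simplex T' = simplex (T ∩ T') := by
  have := 𝒯.complex.convexHull_inter_convexHull (𝒯.mem_elements.1 hT).1 (𝒯.mem_elements.1 hT').1
  simpa [simplex] using this

theorem card_inter_le {T T' : Finset (Space d)} (hT : T ∈ 𝒯.elements) (hT' : T' ∈ 𝒯.elements)
    (hne : T ≠ T') : (T ∩ T').card ≤ d := by
  have h1 := (𝒯.mem_elements.1 hT).2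
  have h2 := (𝒯.mem_elements.1 hT').2
  by_contra! h
  have h3 : T ∩ T' = T := Finset.eq_of_subset_of_card_le Finset.inter_subset_left (by omega)
  have h4 : T ∩ T' = T' := Finset.eq_of_subset_of_card_le Finset.inter_subset_right (by omega)
  exact hne (h3.symm.trans h4)

theorem exists_mem_simplex {x : Space d} (hx : x ∈ closure Ω) :
    ∃ T ∈ 𝒯.elements, x ∈ simplex T := by
  rw [← 𝒯.space_eq, Geometry.SimplicialComplex.mem_space_iff] at hx
  obtain ⟨s, hs, hxs⟩ := hx
  obtain ⟨T, hT, hsT, hcard⟩ := 𝒯.pure s hs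
  exact ⟨T, 𝒯.mem_elements.2 ⟨hT, hcard⟩, simplex_mono hsT hxs⟩

theorem aedisjoint {T T' : Finset (Space d)} (hT : T ∈ 𝒯.elements) (hT' : T' ∈ 𝒯.elements)
    (hne : T ≠ T') : AEDisjoint volume (simplex T) (simplex T') := by
  rw [AEDisjoint, simplex_inter hT hT']
  exact measure_mono_null (simplex_subset_affineSpan _)
    (volume_affineSpan_eq_zero (card_inter_le hT hT' hne))

theorem interior_simplex_nonempty {T : Finset (Space d)} (hT : T ∈ 𝒯.elements) :
    (interior (simplex T)).Nonempty := by
  obtain ⟨hf, hcard⟩ := 𝒯.mem_elements.1 hT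
  rw [simplex, interior_convexHull_nonempty_iff_affineSpan_eq_top]
  have h := (𝒯.complex.indep hf).affineSpan_eq_top_iff_card_eq_finrank_add_one
  rw [Subtype.range_coe_subtype] at h
  exact h.2 (by simp [hcard])

theorem volume_simplex_inter_pos {T : Finset (Space d)} (hT : T ∈ 𝒯.elements) {B : Set (Space d)}
    (hB : IsOpen B) (hne : (simplex T ∩ B).Nonempty) : 0 < volume (simplex T ∩ B) := by
  obtain ⟨x, hxT, hxB⟩ := hne
  have hcl : x ∈ closure (interior (simplex T)) := by
    rw [(convex_simplex T).closure_interior_eq_closure_of_nonempty_interior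
      (interior_simplex_nonempty hT)]
    exact subset_closure hxT
  obtain ⟨y, hyB, hyT⟩ := mem_closure_iff.1 hcl B hB hxB
  exact ((isOpen_interior.inter hB).measure_pos volume ⟨y, hyT, hyB⟩).trans_le
    (measure_mono (Set.inter_subset_inter_left _ interior_subset))

/-- Two elements are adjacent across `U` if they share a `(d-1)`-dimensional face that meets `U`. -/
def AdjAcross (𝒯 : Mesh Ω) (U : Set (Space d)) (T T' : Finset (Space d)) : Prop :=
  T ∈ 𝒯.elements ∧ T' ∈ 𝒯.elements ∧ T ≠ T' ∧
    ∃ F : Finset (Space d), F.card = d ∧ F ⊆ T ∧ F ⊆ T' ∧ (simplex F ∩ U).Nonempty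

theorem AdjAcross.mono {U U' : Set (Space d)} (h : U ⊆ U') {T T' : Finset (Space d)}
    (hadj : 𝒯.AdjAcross U T T') : 𝒯.AdjAcross U' T T' := by
  obtain ⟨h1, h2, h3, F, h4, h5, h6, h7⟩ := hadj
  exact ⟨h1, h2, h3, F, h4, h5, h6, h7.mono (Set.inter_subset_inter_right _ h)⟩

theorem isClosed_biUnion_simplex (A : Finset (Finset (Space d))) :
    IsClosed (⋃ T ∈ A, simplex T) :=
  A.finite_toSet.isClosed_biUnion fun T _ => (isCompact_simplex T).isClosed

/-- If a relation on the elements holds whenever two elements have a common point in the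
preconnected set `U`, then its reflexive transitive closure relates all elements that meet `U`. -/
theorem reflTransGen_of_isPreconnected {U : Set (Space d)} (hU : IsPreconnected U)
    (hUΩ : U ⊆ closure Ω) {r : Finset (Space d) → Finset (Space d) → Prop}
    (hr : ∀ T₁ ∈ 𝒯.elements, ∀ T₂ ∈ 𝒯.elements, T₁ ≠ T₂ → ∀ x ∈ U, x ∈ simplex T₁ → x ∈ simplex T₂ →
      Relation.ReflTransGen r T₁ T₂)
    {T T' : Finset (Space d)} (hT : T ∈ 𝒯.elements) (hT' : T' ∈ 𝒯.elements)
    (hTU : (simplex T ∩ U).Nonempty) (hTU' : (simplex T' ∩ U).Nonempty) :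
    Relation.ReflTransGen r T T' := by
  by_contra hcon
  obtain ⟨x, hxT, hxU⟩ := hTU
  obtain ⟨y, hyT, hyU⟩ := hTU'
  set A := 𝒯.elements.filter (fun T₁ => Relation.ReflTransGen r T T₁) with hA
  set B := 𝒯.elements.filter (fun T₁ => ¬ Relation.ReflTransGen r T T₁) with hB
  have hcov : U ⊆ (⋃ T₁ ∈ A, simplex T₁) ∪ ⋃ T₁ ∈ B, simplex T₁ := by
    intro z hz
    obtain ⟨T₁, hT₁, hzT₁⟩ := 𝒯.exists_mem_simplex (hUΩ hz)
    by_cases h : Relation.ReflTransGen r T T₁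
    · exact Or.inl (Set.mem_iUnion₂.2 ⟨T₁, Finset.mem_filter.2 ⟨hT₁, h⟩, hzT₁⟩)
    · exact Or.inr (Set.mem_iUnion₂.2 ⟨T₁, Finset.mem_filter.2 ⟨hT₁, h⟩, hzT₁⟩)
  have hxA : x ∈ ⋃ T₁ ∈ A, simplex T₁ :=
    Set.mem_iUnion₂.2 ⟨T, Finset.mem_filter.2 ⟨hT, .refl⟩, hxT⟩
  have hyB : y ∈ ⋃ T₁ ∈ B, simplex T₁ :=
    Set.mem_iUnion₂.2 ⟨T', Finset.mem_filter.2 ⟨hT', hcon⟩, hyT⟩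
  obtain ⟨z, hzU, hzA, hzB⟩ := isPreconnected_closed_iff.1 hU _ _ (isClosed_biUnion_simplex A)
    (isClosed_biUnion_simplex B) hcov ⟨x, hxU, hxA⟩ ⟨y, hyU, hyB⟩
  obtain ⟨T₁, hT₁, hz₁⟩ := Set.mem_iUnion₂.1 hzA
  obtain ⟨T₂, hT₂, hz₂⟩ := Set.mem_iUnion₂.1 hzB
  obtain ⟨hT₁, hr₁⟩ := Finset.mem_filter.1 hT₁
  obtain ⟨hT₂, hr₂⟩ := Finset.mem_filter.1 hT₂
  refine hr₂ (hr₁.trans (hr T₁ hT₁ T₂ hT₂ ?_ z hzU hz₁ hz₂))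
  rintro rfl
  exact hr₂ hr₁

/-- A set of positive volume has a point outside finitely many sets of volume zero. -/
theorem exists_mem_forall_notMem {A : Set (Space d)} (hA : 0 < volume A) {ι : Type*} (s : Finset ι)
    (f : ι → Set (Space d)) (hf : ∀ j ∈ s, volume (f j) = 0) : ∃ x ∈ A, ∀ j ∈ s, x ∉ f j := by
  by_contra! h
  have h1 : A ⊆ ⋃ j ∈ s, f j := fun x hx => by
    obtain ⟨j, hj, hxj⟩ := h x hx
    exact Set.mem_biUnion (Finset.mem_coe.2 hj) hxj
  exact hA.ne' (measure_mono_null h1 ((measure_biUnion_null_iff s.countable_toSet).2 hf))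

/-- In a convex open set two elements are connected through faces: a generic segment between them
does not meet the skeleton of dimension `d - 2`, so it passes from element to element through
common faces of dimension `d - 1`. -/
theorem reflTransGen_adjAcross_of_convex {B : Set (Space d)} (hBo : IsOpen B) (hBc : Convex ℝ B)
    (hBΩ : B ⊆ closure Ω) {T T' : Finset (Space d)} (hT : T ∈ 𝒯.elements) (hT' : T' ∈ 𝒯.elements)
    (hTB : (simplex T ∩ B).Nonempty) (hTB' : (simplex T' ∩ B).Nonempty) :
    Relation.ReflTransGen (𝒯.AdjAcross B) T T' := by
  set S := 𝒯.finite.toFinset.filter (fun s => s.card < d) with hS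
  have hScard : ∀ s ∈ S, s.card < d := fun s hs => (Finset.mem_filter.1 hs).2
  obtain ⟨x, ⟨hxT, hxB⟩, hx⟩ := exists_mem_forall_notMem (volume_simplex_inter_pos hT hBo hTB) S
    (fun s => (affineSpan ℝ (s : Set (Space d)) : Set (Space d)))
    (fun s hs => volume_affineSpan_eq_zero (hScard s hs).le)
  -- `y` avoids the spans of `x` and the small faces, so that the segment from `x` to `y` avoids the
  -- small faces.
  obtain ⟨y, ⟨hyT, hyB⟩, hy⟩ := exists_mem_forall_notMem (volume_simplex_inter_pos hT' hBo hTB') S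
    (fun s => (affineSpan ℝ ((insert x s : Finset (Space d)) : Set (Space d)) : Set (Space d)))
    (fun s hs => volume_affineSpan_eq_zero ((Finset.card_insert_le x s).trans (hScard s hs)))
  have hseg : segment ℝ x y ⊆ B := hBc.segment_subset hxB hyB
  refine reflTransGen_of_isPreconnected (U := segment ℝ x y) (convex_segment x y).isPreconnected
    (hseg.trans hBΩ) ?_ hT hT' ⟨x, hxT, left_mem_segment ℝ x y⟩ ⟨y, hyT, right_mem_segment ℝ x y⟩
  intro T₁ hT₁ T₂ hT₂ hne z hz hz₁ hz₂
  have hzI : z ∈ simplex (T₁ ∩ T₂) := by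
    rw [← simplex_inter hT₁ hT₂]
    exact ⟨hz₁, hz₂⟩
  refine .single ⟨hT₁, hT₂, hne, T₁ ∩ T₂, ?_, Finset.inter_subset_left, Finset.inter_subset_right,
    z, hzI, hseg hz⟩
  by_contra hcard
  have hlt : (T₁ ∩ T₂).card < d := lt_of_le_of_ne (card_inter_le hT₁ hT₂ hne) hcard
  have hIne : (T₁ ∩ T₂).Nonempty := by
    have : (simplex (T₁ ∩ T₂)).Nonempty := ⟨z, hzI⟩
    rw [simplex, convexHull_nonempty_iff] at this
    exact_mod_cast this
  have hIS : T₁ ∩ T₂ ∈ S := by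
    rw [hS, Finset.mem_filter, Set.Finite.mem_toFinset]
    exact ⟨𝒯.complex.down_closed (𝒯.mem_elements.1 hT₁).1 Finset.inter_subset_left hIne, hlt⟩
  have hzspan := simplex_subset_affineSpan _ hzI
  rw [segment_eq_image_lineMap] at hz
  obtain ⟨t, -, rfl⟩ := hz
  by_cases ht : t = 0
  · subst ht
    rw [AffineMap.lineMap_apply_zero] at hzspan
    exact hx _ hIS hzspan
  · apply hy _ hIS
    have h1 : x ∈ affineSpan ℝ ((insert x (T₁ ∩ T₂) : Finset (Space d)) : Set (Space d)) :=
      subset_affineSpan ℝ _ (by simp)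
    have h2 : AffineMap.lineMap x y t ∈
        affineSpan ℝ ((insert x (T₁ ∩ T₂) : Finset (Space d)) : Set (Space d)) :=
      affineSpan_mono ℝ (by exact_mod_cast Finset.subset_insert _ _) hzspan
    have h3 := AffineMap.lineMap_mem (t⁻¹) h1 h2
    have h4 : AffineMap.lineMap x (AffineMap.lineMap x y t) t⁻¹ = y := by
      simp [AffineMap.lineMap_apply, smul_smul, inv_mul_cancel₀ ht]
    rw [h4] at h3
    exact h3

/-- The elements that meet an open connected set `U` are connected through faces that meet `U`. -/
theorem reflTransGen_adjAcross {U : Set (Space d)} (hUo : IsOpen U) (hU : IsPreconnected U)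
    (hUΩ : U ⊆ closure Ω) {T T' : Finset (Space d)} (hT : T ∈ 𝒯.elements) (hT' : T' ∈ 𝒯.elements)
    (hTU : (simplex T ∩ U).Nonempty) (hTU' : (simplex T' ∩ U).Nonempty) :
    Relation.ReflTransGen (𝒯.AdjAcross U) T T' := by
  refine reflTransGen_of_isPreconnected hU hUΩ ?_ hT hT' hTU hTU'
  intro T₁ hT₁ T₂ hT₂ _ z hz hz₁ hz₂
  obtain ⟨δ, hδ, hb⟩ := Metric.isOpen_iff.1 hUo z hz
  have hzb := Metric.mem_ball_self (x := z) hδ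
  exact Relation.ReflTransGen.mono (fun _ _ h => AdjAcross.mono hb h) _ _
    (reflTransGen_adjAcross_of_convex Metric.isOpen_ball (convex_ball z δ) (hb.trans hUΩ) hT₁ hT₂
      ⟨z, hz₁, hzb⟩ ⟨z, hz₂, hzb⟩)

theorem exists_closedBall_subset {σ κ h : ℝ} (hσ : 0 < σ)
    (hreg : 𝒯.ShapeRegular σ) (hqu : 𝒯.QuasiUniform κ h) {T : Finset (Space d)}
    (hT : T ∈ 𝒯.elements) : ∃ x, Metric.closedBall x (1 / (κ * σ) * h) ⊆ simplex T := by
  obtain ⟨x, hx⟩ := hreg T hT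
  refine ⟨x, (Metric.closedBall_subset_closedBall ?_).trans hx⟩
  rw [show 1 / (κ * σ) * h = h / κ / σ by field_simp]
  have := (hqu T hT).1
  gcongr

/-- By comparing volumes, only boundedly many elements meet a ball of radius `R h`. -/
theorem card_le_of_meets_closedBall {σ κ h R : ℝ} (hσ : 0 < σ) (hκ : 0 < κ) (hh : 0 < h)
    (hR : 0 ≤ R) (hreg : 𝒯.ShapeRegular σ) (hqu : 𝒯.QuasiUniform κ h) (z : Space d)
    {A : Finset (Finset (Space d))} (hA : A ⊆ 𝒯.elements)
    (hmeet : ∀ T ∈ A, (simplex T ∩ Metric.closedBall z (R * h)).Nonempty) :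
    (A.card : ℝ) ≤ ((R + κ) * (κ * σ)) ^ d := by
  set m := volume.real (Metric.closedBall (0 : Space d) 1) with hm
  have hm0 : 0 < m := volume_real_unitBall_pos
  have hsub : (⋃ T ∈ A, simplex T) ⊆ Metric.closedBall z ((R + κ) * h) := by
    intro x hx
    obtain ⟨T, hT, hxT⟩ := Set.mem_iUnion₂.1 hx
    obtain ⟨y, hyT, hy⟩ := hmeet T hT
    have h1 := (dist_le_size hxT hyT).trans (hqu T (hA hT)).2
    have h2 := Metric.mem_closedBall.1 hy
    have h3 := dist_triangle x y z
    rw [Metric.mem_closedBall]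
    linarith
  have hsum : volume.real (⋃ T ∈ A, simplex T) = ∑ T ∈ A, volume.real (simplex T) := by
    rw [measureReal_def, measure_biUnion_finset₀
      (fun T hT T' hT' hne => aedisjoint (hA hT) (hA hT') hne)
      (fun T _ => (isCompact_simplex T).measurableSet.nullMeasurableSet),
      ENNReal.toReal_sum fun T _ => (isCompact_simplex T).measure_lt_top.ne]
    rfl
  have h1 := measureReal_mono (μ := volume) hsub measure_closedBall_lt_top.ne
  rw [hsum, volume_real_closedBall z (by positivity)] at h1
  have h2 : ∀ T ∈ A, (1 / (κ * σ) * h) ^ d * m ≤ volume.real (simplex T) := by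
    intro T hT
    obtain ⟨x, hx⟩ := exists_closedBall_subset hσ hreg hqu (hA hT)
    rw [hm, ← volume_real_closedBall x (by positivity)]
    exact measureReal_mono hx (isCompact_simplex T).measure_lt_top.ne
  have h3 := (Finset.card_nsmul_le_sum A _ _ h2).trans h1
  rw [nsmul_eq_mul, ← mul_assoc] at h3
  have h4 := le_of_mul_le_mul_right h3 hm0
  rw [mul_pow, mul_pow, ← mul_assoc] at h4
  have h5 := le_of_mul_le_mul_right h4 (by positivity : 0 < h ^ d)
  rw [one_div, inv_pow, ← div_eq_mul_inv, div_le_iff₀ (by positivity)] at h5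
  rwa [mul_pow]

end Mesh

/-! ### The measure of faces -/

section FaceMeasure

variable {d : ℕ}

/-- A disc of radius `r` in an `m`-dimensional affine subspace has the `m`-dimensional measure of a
ball of radius `r` in `ℝ^m`. -/
theorem euclideanHausdorffMeasure_disc {m : ℕ} (V : Submodule ℝ (Space d))
    (hV : Module.finrank ℝ V = m) (f : Space d) (r : ℝ) :
    (μHE[m] : Measure (Space d)) {x | ∃ e ∈ V, ‖e‖ ≤ r ∧ x = f + e} =
      volume (Metric.closedBall (0 : Space m) r) := by
  set b := ((stdOrthonormalBasis ℝ V).reindex (finCongr hV)).repr with hb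
  set g : Space m → Space d := fun u => f + (b.symm u : Space d) with hg
  have hgi : Isometry g := by
    refine Isometry.of_dist_eq fun u w => ?_
    simp only [hg, dist_add_left]
    rw [← Subtype.dist_eq, b.symm.isometry.dist_eq]
  have himg : {x | ∃ e ∈ V, ‖e‖ ≤ r ∧ x = f + e} = g '' Metric.closedBall (0 : Space m) r := by
    ext x
    constructor
    · rintro ⟨e, he, hr, rfl⟩
      refine ⟨b ⟨e, he⟩, ?_, by simp [hg]⟩
      rw [mem_closedBall_zero_iff, b.norm_map]
      exact hr
    · rintro ⟨u, hu, rfl⟩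
      refine ⟨b.symm u, (b.symm u).2, ?_, rfl⟩
      rw [mem_closedBall_zero_iff, ← b.symm.norm_map] at hu
      exact hu
  rw [himg, hgi.euclideanHausdorffMeasure_image, EuclideanSpace.euclideanHausdorffMeasure_eq_volume]

theorem finrank_vectorSpan_face {F : Finset (Space d)} (hd : 1 ≤ d) (hcard : F.card = d)
    (hind : AffineIndependent ℝ ((↑) : F → Space d)) :
    Module.finrank ℝ (vectorSpan ℝ (F : Set (Space d))) = d - 1 := by
  have := hind.finrank_vectorSpan (n := d - 1) (by simp [hcard]; omega)
  rwa [Subtype.range_coe_subtype] at this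

/-- A facet of a simplex that contains a ball of radius `ρ` contains a disc of radius `ρ`: the
central projection of the section of the ball by the plane parallel to the facet, from the opposite
vertex. -/
theorem exists_disc_subset_face {T F : Finset (Space d)} (hd : 2 ≤ d) (hT : T.card = d + 1)
    (hind : AffineIndependent ℝ ((↑) : T → Space d)) (hFT : F ⊆ T) (hF : F.card = d)
    {x : Space d} {ρ : ℝ} (hρ : 0 < ρ) (hx : Metric.closedBall x ρ ⊆ simplex T) :
    ∃ f ∈ simplex F, ∀ e ∈ vectorSpan ℝ (F : Set (Space d)), ‖e‖ ≤ ρ → f + e ∈ simplex F := by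
  set V := vectorSpan ℝ (F : Set (Space d)) with hV
  have hFind : AffineIndependent ℝ ((↑) : F → Space d) := hind.mono (by exact_mod_cast hFT)
  have hVrank : Module.finrank ℝ V = d - 1 := finrank_vectorSpan_face (by omega) hF hFind
  have hFne : F.Nonempty := Finset.card_pos.1 (by omega)
  obtain ⟨a, haF, rfl⟩ : ∃ a, a ∉ F ∧ insert a F = T := by
    obtain ⟨a, ha⟩ : (T \ F).Nonempty := by
      rw [← Finset.card_pos, Finset.card_sdiff_of_subset hFT]
      omega
    obtain ⟨haT, haF⟩ := Finset.mem_sdiff.1 ha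
    exact ⟨a, haF, Finset.eq_of_subset_of_card_le (Finset.insert_subset haT hFT)
      (by rw [Finset.card_insert_of_notMem haF]; omega)⟩
  have hspan : a ∉ affineSpan ℝ (F : Set (Space d)) := by
    intro ha
    have h1 : vectorSpan ℝ ((insert a F : Finset (Space d)) : Set (Space d)) = V := by
      rw [Finset.coe_insert, vectorSpan_insert_eq_vectorSpan ha]
    have h2 := hind.finrank_vectorSpan (n := d) (by simp [Finset.card_insert_of_notMem haF, hF])
    rw [Subtype.range_coe_subtype] at h2
    have h3 : Module.finrank ℝ V = d := by
      rw [← h1]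
      exact h2
    omega
  have hVF : ∀ f ∈ simplex F, ∀ f' ∈ simplex F, f - f' ∈ V := by
    intro f hf f' hf'
    have := AffineSubspace.vsub_mem_direction (simplex_subset_affineSpan F hf)
      (simplex_subset_affineSpan F hf')
    rwa [direction_affineSpan] at this
  have hcone : ∀ y ∈ simplex (insert a F), ∃ s : ℝ, 0 ≤ s ∧ s ≤ 1 ∧ ∃ f ∈ simplex F,
      y = (1 - s) • a + s • f := by
    intro y hy
    rw [simplex, Finset.coe_insert, convexHull_insert (by exact_mod_cast hFne),
      mem_convexJoin] at hy
    obtain ⟨a', ha', f, hf, hy⟩ := hy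
    rw [Set.mem_singleton_iff] at ha'
    subst ha'
    obtain ⟨s, t, hs, ht, hst, rfl⟩ := hy
    exact ⟨t, ht, by linarith, f, hf, by rw [← hst]; simp⟩
  -- The distance parameter `s` from the opposite vertex is constant along the directions of `F`.
  have hsame : ∀ s s' : ℝ, ∀ f ∈ simplex F, ∀ f' ∈ simplex F,
      ((1 - s') • a + s' • f') - ((1 - s) • a + s • f) ∈ V → s' = s := by
    intro s s' f hf f' hf' hmem
    by_contra hne
    have h1 : (s - s') • (a - f') ∈ V := by
      have h2 := V.add_mem hmem (V.smul_mem s (hVF f hf f' hf'))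
      convert h2 using 1
      module
    have h3 : a - f' ∈ V := (V.smul_mem_iff (sub_ne_zero.2 (Ne.symm hne))).1 h1
    apply hspan
    have h4 := AffineSubspace.vadd_mem_of_mem_direction
      (by rw [direction_affineSpan]; exact h3) (simplex_subset_affineSpan F hf')
    simpa using h4
  obtain ⟨s, hs0, hs1, f, hf, hxf⟩ := hcone x (hx (Metric.mem_closedBall_self hρ.le))
  have hmove : ∀ e ∈ V, ‖e‖ ≤ ρ → ∃ f' ∈ simplex F, x + e = (1 - s) • a + s • f' := by
    intro e he hn
    obtain ⟨s', -, -, f', hf', hxf'⟩ := hcone (x + e) (hx (by simpa [dist_eq_norm] using hn))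
    have h1 : s' = s := hsame s s' f hf f' hf' (by
      rw [← hxf, ← hxf', add_sub_cancel_left]
      exact he)
    exact ⟨f', hf', by rw [← h1]; exact hxf'⟩
  have hs : s ≠ 0 := by
    rintro rfl
    have hVne : V ≠ ⊥ := by
      intro h
      rw [h, finrank_bot] at hVrank
      omega
    obtain ⟨e, heV, he0⟩ := V.exists_mem_ne_zero_of_ne_bot hVne
    have hen : 0 < ‖e‖ := norm_pos_iff.2 he0
    obtain ⟨f', -, h1⟩ := hmove ((ρ / ‖e‖) • e) (V.smul_mem _ heV) (by
      rw [norm_smul, Real.norm_of_nonneg (by positivity)]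
      field_simp
      rfl)
    rw [hxf] at h1
    simp only [sub_zero, one_smul, zero_smul, add_zero, add_eq_left, smul_eq_zero] at h1
    rcases h1 with h1 | h1
    · exact (div_pos hρ hen).ne' h1
    · exact he0 h1
  refine ⟨f, hf, fun e he hn => ?_⟩
  obtain ⟨f', hf', h1⟩ := hmove (s • e) (V.smul_mem s he) (by
    rw [norm_smul, Real.norm_of_nonneg hs0]
    calc s * ‖e‖ ≤ 1 * ‖e‖ := by gcongr
      _ ≤ ρ := by linarith)
  rw [hxf, add_assoc, ← smul_add, add_right_inj] at h1
  rw [smul_right_injective _ hs h1]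
  exact hf'

/-- A facet is contained in a disc whose radius is the diameter of the simplex. -/
theorem face_measure_le {T F : Finset (Space d)} (hd : 1 ≤ d)
    (hind : AffineIndependent ℝ ((↑) : F → Space d)) (hFT : F ⊆ T) (hF : F.card = d) :
    (μHE[d - 1] : Measure (Space d)) (simplex F) ≤
      volume (Metric.closedBall (0 : Space (d - 1)) (Mesh.size T)) := by
  obtain ⟨f, hf⟩ : F.Nonempty := Finset.card_pos.1 (by omega)
  have hfF : f ∈ simplex F := subset_convexHull ℝ _ hf
  rw [← euclideanHausdorffMeasure_disc _ (finrank_vectorSpan_face hd hF hind) f]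
  refine measure_mono fun x hx => ⟨x - f, ?_, ?_, by abel⟩
  · have := AffineSubspace.vsub_mem_direction (simplex_subset_affineSpan F hx)
      (simplex_subset_affineSpan F hfF)
    rwa [direction_affineSpan] at this
  · rw [← dist_eq_norm]
    exact dist_le_size (simplex_mono hFT hx) (simplex_mono hFT hfF)

theorem face_measure_lt_top {F : Finset (Space d)} (hd : 1 ≤ d)
    (hind : AffineIndependent ℝ ((↑) : F → Space d)) (hF : F.card = d) :
    (μHE[d - 1] : Measure (Space d)) (simplex F) < ⊤ :=
  (face_measure_le hd hind subset_rfl hF).trans_lt measure_closedBall_lt_top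

/-- A ball around a point of a facet contains a copy of the facet, scaled by the factor `ε`, and
therefore a disc of radius `ε ρ`. -/
theorem le_face_inter_measure {T F : Finset (Space d)} (hd : 2 ≤ d) (hT : T.card = d + 1)
    (hind : AffineIndependent ℝ ((↑) : T → Space d)) (hFT : F ⊆ T) (hF : F.card = d)
    {x : Space d} {ρ : ℝ} (hρ : 0 < ρ) (hx : Metric.closedBall x ρ ⊆ simplex T)
    {q : Space d} (hq : q ∈ simplex F) {ε r : ℝ} (hε : 0 < ε) (hε1 : ε ≤ 1)
    (hr : ε * Mesh.size T < r) {D : Set (Space d)} (hD : Metric.ball q r ⊆ D) :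
    (ε * ρ) ^ (d - 1) * volume.real (Metric.closedBall (0 : Space (d - 1)) 1) ≤
      (μHE[d - 1] : Measure (Space d)).real (simplex F ∩ D) := by
  have hFind : AffineIndependent ℝ ((↑) : F → Space d) := hind.mono (by exact_mod_cast hFT)
  have hrank := finrank_vectorSpan_face (by omega) hF hFind
  obtain ⟨f, hf, hdisc⟩ := exists_disc_subset_face hd hT hind hFT hF hρ hx
  rw [← volume_real_closedBall 0 (by positivity), measureReal_def,
    ← euclideanHausdorffMeasure_disc _ hrank (q + ε • (f - q))]
  refine measureReal_mono ?_ ((measure_mono Set.inter_subset_left).trans_lt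
    (face_measure_lt_top (by omega) hFind hF)).ne
  rintro _ ⟨e, he, hen, rfl⟩
  have h1 : f + ε⁻¹ • e ∈ simplex F := by
    refine hdisc _ (Submodule.smul_mem _ _ he) ?_
    rw [norm_smul, Real.norm_of_nonneg (by positivity), inv_mul_le_iff₀ hε]
    exact hen
  have h2 : q + ε • (f - q) + e = (1 - ε) • q + ε • (f + ε⁻¹ • e) := by
    rw [smul_add, smul_smul, mul_inv_cancel₀ hε.ne', one_smul]
    module
  refine ⟨?_, hD ?_⟩
  · rw [h2]
    exact convex_simplex F hq h1 (by linarith) hε.le (by ring)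
  · rw [h2, Metric.mem_ball, dist_eq_norm,
      show (1 - ε) • q + ε • (f + ε⁻¹ • e) - q = ε • ((f + ε⁻¹ • e) - q) by module, norm_smul,
      Real.norm_of_nonneg hε.le, ← dist_eq_norm]
    refine lt_of_le_of_lt ?_ hr
    gcongr
    exact dist_le_size (simplex_mono hFT h1) (simplex_mono hFT hq)

end FaceMeasure

/-! ### Jumps of piecewise affine functions -/

section AffineFunctions

variable {d : ℕ}

theorem hasGradientAt_affineMap (f : Space d →ᵃ[ℝ] ℝ) (x : Space d) :
    HasGradientAt f ((InnerProductSpace.toDual ℝ (Space d)).symm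
      (LinearMap.toContinuousLinearMap f.linear)) x := by
  rw [hasGradientAt_iff_hasFDerivAt, LinearIsometryEquiv.apply_symm_apply]
  have h := (LinearMap.toContinuousLinearMap f.linear).hasFDerivAt (x := x)
  refine (h.add_const (f 0)).congr_of_eventuallyEq (Filter.Eventually.of_forall fun y => ?_)
  exact congrFun (AffineMap.decomp f) y

theorem gradient_affineMap_eq (f : Space d →ᵃ[ℝ] ℝ) (x : Space d) :
    gradient f x = gradient f 0 :=
  (hasGradientAt_affineMap f x).gradient.trans (hasGradientAt_affineMap f 0).gradient.symm

theorem abs_sub_le_norm_gradient_mul_dist (f : Space d →ᵃ[ℝ] ℝ) (x y : Space d) :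
    |f x - f y| ≤ ‖gradient f 0‖ * dist x y := by
  rw [(hasGradientAt_affineMap f 0).gradient, LinearIsometryEquiv.norm_map, dist_eq_norm,
    ← vsub_eq_sub (f x) (f y), ← AffineMap.linearMap_vsub, ← Real.norm_eq_abs, vsub_eq_sub]
  exact (LinearMap.toContinuousLinearMap f.linear).le_opNorm (x - y)

end AffineFunctions

section DoubleSums

variable {ι : Type*}

theorem le_half_double_sum (A : Finset ι) (f : ι → ι → ℝ) (hf : ∀ a b, 0 ≤ f a b)
    (hsymm : ∀ a b, f a b = f b a) {a b : ι} (ha : a ∈ A) (hb : b ∈ A) (hab : a ≠ b) :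
    f a b ≤ 1 / 2 * ∑ a' ∈ A, ∑ b' ∈ A, f a' b' := by
  have hsub : ({a, b} : Finset ι) ⊆ A := by
    simp [Finset.insert_subset_iff, ha, hb]
  have h1 : ∑ a' ∈ ({a, b} : Finset ι), ∑ b' ∈ ({a, b} : Finset ι), f a' b' ≤
      ∑ a' ∈ A, ∑ b' ∈ A, f a' b' :=
    (Finset.sum_le_sum fun a' _ =>
      Finset.sum_le_sum_of_subset_of_nonneg hsub fun b' _ _ => hf a' b').trans
      (Finset.sum_le_sum_of_subset_of_nonneg hsub fun a' _ _ =>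
        Finset.sum_nonneg fun b' _ => hf a' b')
  rw [Finset.sum_pair hab, Finset.sum_pair hab, Finset.sum_pair hab] at h1
  have := hf a a
  have := hf b b
  have := hsymm a b
  linarith

theorem half_double_sum_le (A : Finset ι) (f : ι → ι → ℝ) {B K : ℝ} (hB : 0 ≤ B)
    (hf : ∀ a ∈ A, ∀ b ∈ A, f a b ≤ B) (hK : (A.card : ℝ) ≤ K) :
    1 / 2 * ∑ a ∈ A, ∑ b ∈ A, f a b ≤ K ^ 2 * B := by
  have h1 : ∑ a ∈ A, ∑ b ∈ A, f a b ≤ ∑ a ∈ A, ∑ b ∈ A, B :=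
    Finset.sum_le_sum fun a ha => Finset.sum_le_sum fun b hb => hf a ha b hb
  simp only [Finset.sum_const, nsmul_eq_mul] at h1
  have h0 : (0 : ℝ) ≤ A.card := Nat.cast_nonneg _
  have hK0 : 0 ≤ K := h0.trans hK
  have h2 : (A.card : ℝ) * (A.card * B) ≤ K * (K * B) := by gcongr
  have h3 : 0 ≤ K * (K * B) := by positivity
  linarith

end DoubleSums

section Jumps

variable {d : ℕ} {S : Finset (Finset (Space d))} (v : S → (Space d →ᵃ[ℝ] ℝ))
  (F : Finset (Space d))

theorem jumpSq_nonneg (x : Space d) : 0 ≤ jumpSq v F x := by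
  unfold jumpSq
  positivity

theorem gradJumpSq_nonneg (x : Space d) : 0 ≤ gradJumpSq v F x := by
  unfold gradJumpSq
  positivity

theorem continuous_jumpSq : Continuous (jumpSq v F) := by
  have : ∀ T : S, Continuous (v T) := fun T => (v T).continuous_of_finiteDimensional
  unfold jumpSq
  fun_prop

theorem gradJumpSq_apply (x : Space d) : gradJumpSq v F x = gradJumpSq v F 0 := by
  unfold gradJumpSq
  congr 1
  refine Finset.sum_congr rfl fun T₁ _ => Finset.sum_congr rfl fun T₂ _ => ?_
  rw [gradient_affineMap_eq (v T₁) x, gradient_affineMap_eq (v T₂) x]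

variable {v F}

theorem sq_sub_le_jumpSq {T₁ T₂ : S} (h₁ : F ⊆ T₁.1) (h₂ : F ⊆ T₂.1) (hne : T₁ ≠ T₂)
    (x : Space d) : (v T₁ x - v T₂ x) ^ 2 ≤ jumpSq v F x :=
  le_half_double_sum (Finset.univ.filter fun T : S => F ⊆ T.1)
    (fun T₁ T₂ => (v T₁ x - v T₂ x) ^ 2) (fun _ _ => sq_nonneg _) (fun _ _ => by ring)
    (by simpa using h₁) (by simpa using h₂) hne

theorem sq_norm_sub_le_gradJumpSq {T₁ T₂ : S} (h₁ : F ⊆ T₁.1) (h₂ : F ⊆ T₂.1) (hne : T₁ ≠ T₂)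
    (x : Space d) : ‖gradient (v T₁) x - gradient (v T₂) x‖ ^ 2 ≤ gradJumpSq v F x :=
  le_half_double_sum (Finset.univ.filter fun T : S => F ⊆ T.1)
    (fun T₁ T₂ => ‖gradient (v T₁) x - gradient (v T₂) x‖ ^ 2) (fun _ _ => sq_nonneg _)
    (fun _ _ => by rw [norm_sub_rev]) (by simpa using h₁) (by simpa using h₂) hne

theorem integrableOn_jumpSq {E : Set (Space d)} (hE : E ⊆ simplex F)
    (hfin : (μHE[d - 1] : Measure (Space d)) (simplex F) < ⊤) :
    IntegrableOn (jumpSq v F) E (μHE[d - 1]) := by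
  obtain ⟨M, hM⟩ := (isCompact_simplex F).exists_bound_of_continuousOn
    (continuous_jumpSq v F).continuousOn
  refine IntegrableOn.mono_set ?_ hE
  exact Measure.integrableOn_of_bounded hfin.ne
    (continuous_jumpSq v F).aestronglyMeasurable
    ((ae_restrict_iff' (isCompact_simplex F).measurableSet).2 (Filter.Eventually.of_forall hM))

/-- On a subset of a face the jump is, at some point, at most its quadratic mean. -/
theorem exists_mul_sq_sub_le {E : Set (Space d)} (hE : E ⊆ simplex F)
    (hfin : (μHE[d - 1] : Measure (Space d)) (simplex F) < ⊤) {m : ℝ} (hm : 0 < m)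
    (hmE : m ≤ (μHE[d - 1] : Measure (Space d)).real E) {T₁ T₂ : S} (h₁ : F ⊆ T₁.1) (h₂ : F ⊆ T₂.1)
    (hne : T₁ ≠ T₂) :
    ∃ p ∈ E, m * (v T₁ p - v T₂ p) ^ 2 ≤ ∫ x in E, jumpSq v F x ∂(μHE[d - 1]) := by
  have hE0 : (μHE[d - 1] : Measure (Space d)) E ≠ 0 := by
    intro h0
    rw [measureReal_def, h0, ENNReal.toReal_zero] at hmE
    linarith
  obtain ⟨p, hp, hle⟩ := exists_le_setAverage hE0 ((measure_mono hE).trans_lt hfin).ne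
    (integrableOn_jumpSq (v := v) hE hfin)
  refine ⟨p, hp, ?_⟩
  rw [setAverage_eq, smul_eq_mul, inv_mul_eq_div, le_div_iff₀ (hm.trans_le hmE)] at hle
  refine le_trans ?_ hle
  rw [mul_comm]
  have := sq_sub_le_jumpSq (v := v) h₁ h₂ hne p
  have := jumpSq_nonneg v F p
  gcongr

theorem mul_sq_norm_sub_le {T₁ T₂ : S} (h₁ : F ⊆ T₁.1) (h₂ : F ⊆ T₂.1) (hne : T₁ ≠ T₂) :
    (μHE[d - 1] : Measure (Space d)).real (simplex F) *
        ‖gradient (v T₁) 0 - gradient (v T₂) 0‖ ^ 2 ≤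
      ∫ x in simplex F, gradJumpSq v F x ∂(μHE[d - 1]) := by
  simp only [gradJumpSq_apply v F, setIntegral_const, smul_eq_mul]
  have := sq_norm_sub_le_gradJumpSq (v := v) h₁ h₂ hne 0
  gcongr

theorem setIntegral_jumpSq_nonneg (E : Set (Space d)) :
    0 ≤ ∫ x in E, jumpSq v F x ∂(μHE[d - 1]) :=
  integral_nonneg fun x => jumpSq_nonneg v F x

theorem setIntegral_gradJumpSq_nonneg (E : Set (Space d)) :
    0 ≤ ∫ x in E, gradJumpSq v F x ∂(μHE[d - 1]) :=
  integral_nonneg fun x => gradJumpSq_nonneg v F x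

variable (v) in
theorem faceStab_nonneg {h : ℝ} (hh : 0 < h) (𝓕 : Finset (Finset (Space d))) :
    0 ≤ faceStab h v 𝓕 := by
  refine Finset.sum_nonneg fun F _ => ?_
  have := setIntegral_jumpSq_nonneg (v := v) (F := F) (simplex F)
  have := setIntegral_gradJumpSq_nonneg (v := v) (F := F) (simplex F)
  positivity

theorem setIntegral_jumpSq_le_faceStab {h : ℝ} (hh : 0 < h) {𝓕 : Finset (Finset (Space d))}
    (hF : F ∈ 𝓕) : ∫ x in simplex F, jumpSq v F x ∂(μHE[d - 1]) ≤ h * faceStab h v 𝓕 := by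
  have h1 := Finset.single_le_sum (f := fun F =>
    h⁻¹ * ∫ x in simplex F, jumpSq v F x ∂(μHE[d - 1]) +
      h * ∫ x in simplex F, gradJumpSq v F x ∂(μHE[d - 1])) (fun F _ => by
      have := setIntegral_jumpSq_nonneg (v := v) (F := F) (simplex F)
      have := setIntegral_gradJumpSq_nonneg (v := v) (F := F) (simplex F)
      positivity) hF
  beta_reduce at h1
  have h2 := setIntegral_gradJumpSq_nonneg (v := v) (F := F) (simplex F)
  have h3 : h⁻¹ * ∫ x in simplex F, jumpSq v F x ∂(μHE[d - 1]) ≤ faceStab h v 𝓕 :=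
    le_trans (le_add_of_nonneg_right (by positivity)) h1
  rwa [inv_mul_le_iff₀ hh] at h3

theorem setIntegral_gradJumpSq_le_faceStab {h : ℝ} (hh : 0 < h) {𝓕 : Finset (Finset (Space d))}
    (hF : F ∈ 𝓕) : h * ∫ x in simplex F, gradJumpSq v F x ∂(μHE[d - 1]) ≤ faceStab h v 𝓕 := by
  have h1 := Finset.single_le_sum (f := fun F =>
    h⁻¹ * ∫ x in simplex F, jumpSq v F x ∂(μHE[d - 1]) +
      h * ∫ x in simplex F, gradJumpSq v F x ∂(μHE[d - 1])) (fun F _ => by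
      have := setIntegral_jumpSq_nonneg (v := v) (F := F) (simplex F)
      have := setIntegral_gradJumpSq_nonneg (v := v) (F := F) (simplex F)
      positivity) hF
  have h2 := setIntegral_jumpSq_nonneg (v := v) (F := F) (simplex F)
  exact le_trans (le_add_of_nonneg_left (by positivity)) h1

/-- If the jumps of the values and of the gradients across a face are bounded, then so are the face
terms; `K` bounds the number of elements at the face. -/
theorem face_terms_le {h K A B m : ℝ} (hh : 0 < h) (hA : 0 ≤ A) (hB : 0 ≤ B)
    (hK : ((Finset.univ.filter fun T : S => F ⊆ T.1).card : ℝ) ≤ K)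
    (hfin : (μHE[d - 1] : Measure (Space d)) (simplex F) < ⊤)
    (hm : (μHE[d - 1] : Measure (Space d)).real (simplex F) ≤ m)
    (hv : ∀ T₁ T₂ : S, F ⊆ T₁.1 → F ⊆ T₂.1 → ∀ x ∈ simplex F, (v T₁ x - v T₂ x) ^ 2 ≤ A)
    (hg : ∀ T₁ T₂ : S, F ⊆ T₁.1 → F ⊆ T₂.1 → ‖gradient (v T₁) 0 - gradient (v T₂) 0‖ ^ 2 ≤ B) :
    h⁻¹ * ∫ x in simplex F, jumpSq v F x ∂(μHE[d - 1]) +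
      h * ∫ x in simplex F, gradJumpSq v F x ∂(μHE[d - 1]) ≤
      h⁻¹ * (m * (K ^ 2 * A)) + h * (m * (K ^ 2 * B)) := by
  have hj : ∀ x ∈ simplex F, jumpSq v F x ≤ K ^ 2 * A := fun x hx =>
    half_double_sum_le _ _ hA (fun T₁ h₁ T₂ h₂ =>
      hv T₁ T₂ (by simpa using h₁) (by simpa using h₂) x hx) hK
  have hgj : gradJumpSq v F 0 ≤ K ^ 2 * B :=
    half_double_sum_le _ _ hB (fun T₁ h₁ T₂ h₂ =>
      hg T₁ T₂ (by simpa using h₁) (by simpa using h₂)) hK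
  have h1 : ∫ x in simplex F, jumpSq v F x ∂(μHE[d - 1]) ≤ m * (K ^ 2 * A) := by
    calc ∫ x in simplex F, jumpSq v F x ∂(μHE[d - 1])
        ≤ ∫ x in simplex F, K ^ 2 * A ∂(μHE[d - 1]) :=
          setIntegral_mono_on (integrableOn_jumpSq subset_rfl hfin)
            (integrableOn_const hfin.ne) (isCompact_simplex F).measurableSet hj
      _ ≤ m * (K ^ 2 * A) := by
          rw [setIntegral_const, smul_eq_mul]
          gcongr
  have h2 : ∫ x in simplex F, gradJumpSq v F x ∂(μHE[d - 1]) ≤ m * (K ^ 2 * B) := by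
    simp only [gradJumpSq_apply v F, setIntegral_const, smul_eq_mul]
    have := gradJumpSq_nonneg v F 0
    have hm0 : 0 ≤ m := measureReal_nonneg.trans hm
    gcongr
  gcongr

end Jumps

/-! ### Regular meshes, chains of elements and local energies -/

namespace Mesh

variable {d : ℕ} {Ω : Set (Space d)} {𝒯 : Mesh Ω} {σ κ h : ℝ}

/-- A shape regular and quasi-uniform mesh at the scale `h`, with positive parameters. -/
structure IsRegular (𝒯 : Mesh Ω) (σ κ h : ℝ) : Prop where
  σ_pos : 0 < σ
  κ_pos : 0 < κ
  h_pos : 0 < h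
  shapeRegular : 𝒯.ShapeRegular σ
  quasiUniform : 𝒯.QuasiUniform κ h

theorem mem_active {D : Set (Space d)} {T : Finset (Space d)} :
    T ∈ 𝒯.active D ↔ T ∈ 𝒯.elements ∧ (simplex T ∩ D).Nonempty :=
  Finset.mem_filter

theorem active_subset (D : Set (Space d)) : 𝒯.active D ⊆ 𝒯.elements := Finset.filter_subset _ _

theorem indep {T : Finset (Space d)} (hT : T ∈ 𝒯.elements) :
    AffineIndependent ℝ ((↑) : T → Space d) :=
  𝒯.complex.indep (𝒯.mem_elements.1 hT).1

theorem simplex_nonempty {T : Finset (Space d)} (hT : T ∈ 𝒯.elements) : (simplex T).Nonempty :=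
  (interior_simplex_nonempty hT).mono interior_subset

theorem IsRegular.dist_le (H : 𝒯.IsRegular σ κ h) {T : Finset (Space d)} (hT : T ∈ 𝒯.elements)
    {x y : Space d} (hx : x ∈ simplex T) (hy : y ∈ simplex T) : dist x y ≤ κ * h :=
  (dist_le_size hx hy).trans (H.quasiUniform T hT).2

theorem IsRegular.size_pos (H : 𝒯.IsRegular σ κ h) {T : Finset (Space d)} (hT : T ∈ 𝒯.elements) :
    0 < size T :=
  (div_pos H.h_pos H.κ_pos).trans_le (H.quasiUniform T hT).1

/-- The simplices with vertices `T` and `T'` contain points at distance at most `r` from each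
other. -/
def Near (r : ℝ) (T T' : Finset (Space d)) : Prop :=
  ∃ x ∈ simplex T, ∃ y ∈ simplex T', dist x y ≤ r

theorem Near.symm {r : ℝ} {T T' : Finset (Space d)} (hn : Near r T T') : Near r T' T := by
  obtain ⟨x, hx, y, hy, hxy⟩ := hn
  exact ⟨y, hy, x, hx, by rwa [dist_comm]⟩

theorem IsRegular.card_near_le (H : 𝒯.IsRegular σ κ h) {R : ℝ} (hR : 0 ≤ R)
    {S : Finset (Finset (Space d))} (hS : S ⊆ 𝒯.elements) {T₀ : Finset (Space d)}
    (hT₀ : T₀ ∈ 𝒯.elements) {A : Finset S} (hA : ∀ T ∈ A, Near (R * h) T₀ T.1) :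
    (A.card : ℝ) ≤ ((R + κ + κ) * (κ * σ)) ^ d := by
  obtain ⟨z, hz⟩ := simplex_nonempty hT₀
  have := H.κ_pos
  rw [← Finset.card_map (Function.Embedding.subtype (· ∈ S))]
  refine card_le_of_meets_closedBall H.σ_pos H.κ_pos H.h_pos (by positivity) H.shapeRegular
    H.quasiUniform z (A := A.map (Function.Embedding.subtype (· ∈ S))) ?_ ?_
  · intro T hT
    obtain ⟨T', -, rfl⟩ := Finset.mem_map.1 hT
    exact hS T'.2
  · intro T hT
    obtain ⟨T', hT', rfl⟩ := Finset.mem_map.1 hT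
    obtain ⟨x, hx, y, hy, hxy⟩ := hA T' hT'
    refine ⟨y, hy, ?_⟩
    have h1 := H.dist_le hT₀ hx hz
    have h2 := dist_triangle_left y z x
    rw [Metric.mem_closedBall]
    linarith

/-- The constant in the lower bound of the measure of a face in a ball of radius `c h`. -/
noncomputable def faceConst (d : ℕ) (σ κ c : ℝ) : ℝ :=
  (min 1 (c / (2 * κ)) * (1 / (κ * σ))) ^ (d - 1) *
    volume.real (Metric.closedBall (0 : Space (d - 1)) 1)

theorem faceConst_pos {c : ℝ} (hσ : 0 < σ) (hκ : 0 < κ) (hc : 0 < c) : 0 < faceConst d σ κ c := by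
  have := volume_real_unitBall_pos (d := d - 1)
  unfold faceConst
  positivity

theorem IsRegular.faceConst_mul_le (H : 𝒯.IsRegular σ κ h) (hd : 2 ≤ d) {T F : Finset (Space d)}
    (hT : T ∈ 𝒯.elements) (hFT : F ⊆ T) (hF : F.card = d) {c : ℝ} (hc : 0 < c) {q : Space d}
    (hq : q ∈ simplex F) {D : Set (Space d)} (hD : Metric.ball q (c * h) ⊆ D) :
    faceConst d σ κ c * h ^ (d - 1) ≤ (μHE[d - 1] : Measure (Space d)).real (simplex F ∩ D) := by
  have := H.κ_pos
  have := H.σ_pos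
  have hh := H.h_pos
  obtain ⟨x, hx⟩ := exists_closedBall_subset H.σ_pos H.shapeRegular H.quasiUniform hT
  have h1 := le_face_inter_measure hd (𝒯.mem_elements.1 hT).2 (indep hT) hFT hF (by positivity) hx
    hq (ε := min 1 (c / (2 * κ))) (r := c * h) (by positivity) (min_le_left _ _) (by
      calc min 1 (c / (2 * κ)) * size T ≤ c / (2 * κ) * (κ * h) := by
            gcongr
            · exact Metric.diam_nonneg
            · exact min_le_right _ _
            · exact (H.quasiUniform T hT).2
        _ = c * h / 2 := by field_simp
        _ < c * h := half_lt_self (by positivity)) hD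
  refine le_trans (le_of_eq ?_) h1
  rw [faceConst, ← mul_assoc, mul_pow _ h]
  ring

theorem measure_face_lt_top (hd : 1 ≤ d) {T F : Finset (Space d)}
    (hT : T ∈ 𝒯.elements) (hFT : F ⊆ T) (hF : F.card = d) :
    (μHE[d - 1] : Measure (Space d)) (simplex F) < ⊤ :=
  face_measure_lt_top hd ((indep hT).mono (by exact_mod_cast hFT)) hF

theorem IsRegular.face_measure_real_le (H : 𝒯.IsRegular σ κ h) (hd : 1 ≤ d) {T F : Finset (Space d)}
    (hT : T ∈ 𝒯.elements) (hFT : F ⊆ T) (hF : F.card = d) :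
    (μHE[d - 1] : Measure (Space d)).real (simplex F) ≤
      κ ^ (d - 1) * volume.real (Metric.closedBall (0 : Space (d - 1)) 1) * h ^ (d - 1) := by
  have := H.κ_pos
  have := H.h_pos
  have h1 := ENNReal.toReal_mono measure_closedBall_lt_top.ne
    (face_measure_le hd ((indep hT).mono (by exact_mod_cast hFT)) hFT hF)
  refine h1.trans ?_
  have h2 : volume.real (Metric.closedBall (0 : Space (d - 1)) (size T)) ≤
      volume.real (Metric.closedBall (0 : Space (d - 1)) (κ * h)) :=
    measureReal_mono (Metric.closedBall_subset_closedBall (H.quasiUniform T hT).2)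
      measure_closedBall_lt_top.ne
  refine h2.trans (le_of_eq ?_)
  rw [volume_real_closedBall _ (by positivity)]
  ring

end Mesh

section Chains

/-- A function that varies by at most `δ` along a relation on a finite set `A` varies by at most
`#A δ` on the connected components of the relation, as two connected points are joined by a path
without repetitions. -/
theorem dist_le_of_reflTransGen {α X : Type*} [PseudoMetricSpace X] {A : Finset α}
    {r : α → α → Prop} {f : α → X} {δ : ℝ} (hδ : 0 ≤ δ)
    (hr : ∀ a b, r a b → a ∈ A ∧ b ∈ A ∧ dist (f a) (f b) ≤ δ) {a b : α}
    (hab : Relation.ReflTransGen r a b) : dist (f a) (f b) ≤ A.card * δ := by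
  have hadj : ∀ a b, (SimpleGraph.fromRel r).Adj a b → a ∈ A ∧ b ∈ A ∧ dist (f a) (f b) ≤ δ := by
    intro a b h
    rcases ((SimpleGraph.fromRel_adj r a b).1 h).2 with h | h
    · exact hr a b h
    · obtain ⟨h1, h2, h3⟩ := hr b a h
      exact ⟨h2, h1, by rwa [dist_comm]⟩
  have hreach : (SimpleGraph.fromRel r).Reachable a b := by
    induction hab with
    | refl => exact SimpleGraph.Reachable.refl _
    | tail _ h ih =>
      rename_i c e _
      by_cases hce : c = e
      · exact hce ▸ ih
      · exact ih.trans (SimpleGraph.Adj.reachable ((SimpleGraph.fromRel_adj r c e).2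
          ⟨hce, Or.inl h⟩))
  obtain ⟨p⟩ := hreach
  have hdist : ∀ {a b : α} (p : (SimpleGraph.fromRel r).Walk a b),
      dist (f a) (f b) ≤ p.length * δ := by
    intro a b p
    induction p with
    | nil => simp
    | cons h p ih =>
      have h1 := (hadj _ _ h).2.2
      have h2 := dist_triangle (f ‹_›) (f ‹_›) (f ‹_›)
      refine (dist_triangle _ _ _).trans ((add_le_add h1 ih).trans (le_of_eq ?_))
      rw [SimpleGraph.Walk.length_cons]
      push_cast
      ring
  have hsupp : ∀ {a b : α} (p : (SimpleGraph.fromRel r).Walk a b), a ∈ A →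
      ∀ x ∈ p.support, x ∈ A := by
    intro a b p
    induction p with
    | nil => simp
    | cons h p ih =>
      intro ha x hx
      rw [SimpleGraph.Walk.support_cons, List.mem_cons] at hx
      rcases hx with rfl | hx
      · exact ha
      · exact ih (hadj _ _ h).2.1 x hx
  by_cases ha : a ∈ A
  · refine (hdist p.toPath.1).trans ?_
    have h1 : p.toPath.1.support.toFinset ⊆ A := fun x hx =>
      hsupp p.toPath.1 ha x (List.mem_toFinset.1 hx)
    have h2 := Finset.card_le_card h1
    rw [List.toFinset_card_of_nodup p.toPath.2.support_nodup, SimpleGraph.Walk.length_support] at h2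
    have h3 : (p.toPath.1.length : ℝ) ≤ A.card := by exact_mod_cast (by omega)
    gcongr
  · cases p with
    | nil => simpa using by positivity
    | cons h _ => exact absurd (hadj _ _ h).1 ha

variable {d : ℕ} {S : Finset (Finset (Space d))} {D : Set (Space d)} {γ : ℝ} {N : ℕ}

/-- A macro element contains an element `T_M` with a large intersection, such that a function on the
elements that varies by at most `δ` across the interior faces of the macro element differs by at
most `N δ` from its value on `T_M`. -/
theorem MacroPartition.exists_root (P : MacroPartition S D γ N) {M : Finset (Finset (Space d))}
    (hM : M ∈ P.macros) : ∃ TM : S, TM.1 ∈ M ∧ LargeIntersection D γ TM.1 ∧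
      ∀ (X : Type) [PseudoMetricSpace X] (f : S → X) (δ : ℝ), 0 ≤ δ →
        (∀ T T' : S, T.1 ∈ M → T'.1 ∈ M → FaceNeighbours T.1 T'.1 → dist (f T) (f T') ≤ δ) →
        ∀ T : S, T.1 ∈ M → dist (f T) (f TM) ≤ N * δ := by
  obtain ⟨TM, hTM, hlarge, hchain⟩ := P.connected M hM
  refine ⟨⟨TM, P.subset M hM hTM⟩, hTM, hlarge, ?_⟩
  intro X _ f δ hδ hf T hT
  obtain ⟨n, c, hn, hc0, hcn, hcM, hcadj⟩ := hchain T.1 hT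
  set g : ℕ → X := fun j => if hj : c j ∈ S then f ⟨c j, hj⟩ else f T with hg
  have hgj : ∀ j (hj : j ≤ n), g j = f ⟨c j, P.subset M hM (hcM j hj)⟩ := fun j hj =>
    dif_pos (P.subset M hM (hcM j hj))
  have h1 : dist (g 0) (g n) ≤ ∑ j ∈ Finset.range n, dist (g j) (g (j + 1)) :=
    dist_le_range_sum_dist g n
  have h2 : ∑ j ∈ Finset.range n, dist (g j) (g (j + 1)) ≤ ∑ j ∈ Finset.range n, δ := by
    refine Finset.sum_le_sum fun j hj => ?_
    have hjn := Finset.mem_range.1 hj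
    rw [hgj j hjn.le, hgj (j + 1) hjn]
    exact hf _ _ (hcM j hjn.le) (hcM (j + 1) hjn) (hcadj j hjn)
  rw [Finset.sum_const, Finset.card_range, nsmul_eq_mul] at h2
  have h3 : g 0 = f T := by
    rw [hgj 0 (Nat.zero_le _)]
    congr 1
    exact Subtype.ext hc0
  have h4 : g n = f ⟨TM, P.subset M hM hTM⟩ := by
    rw [hgj n le_rfl]
    congr 1
    exact Subtype.ext hcn
  rw [h3, h4] at h1
  refine h1.trans (h2.trans ?_)
  gcongr

theorem mem_interiorFaces_of_subset {M : Finset (Finset (Space d))} {T T' F : Finset (Space d)}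
    (hT : T ∈ M) (hT' : T' ∈ M) (hne : T ≠ T') (hF : F.card = d) (hFT : F ⊆ T) (hFT' : F ⊆ T') :
    F ∈ interiorFaces M := by
  rw [interiorFaces, Finset.mem_filter, Finset.mem_biUnion]
  exact ⟨⟨T, hT, Finset.mem_powersetCard.2 ⟨hFT, hF⟩⟩, T, hT, T', hT', hne, hFT, hFT'⟩

theorem exists_of_mem_interiorFaces {M : Finset (Finset (Space d))} {F : Finset (Space d)}
    (hF : F ∈ interiorFaces M) : F.card = d ∧ ∃ T ∈ M, F ⊆ T := by
  rw [interiorFaces, Finset.mem_filter, Finset.mem_biUnion] at hF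
  obtain ⟨⟨T, hT, hFT⟩, -⟩ := hF
  obtain ⟨h1, h2⟩ := Finset.mem_powersetCard.1 hFT
  exact ⟨h2, T, hT, h1⟩

end Chains

section LocalEnergy

variable {d : ℕ} {S : Finset (Finset (Space d))} {D : Set (Space d)} {γ : ℝ} {N : ℕ}

/-- The energy of `∇v` on the cut element `T ∩ D`. -/
noncomputable def cutEnergy (D : Set (Space d)) (v : S → (Space d →ᵃ[ℝ] ℝ)) (T : S) : ℝ :=
  ∫ x in simplex T.1 ∩ D, ‖gradient (v T) x‖ ^ 2

/-- The part of the controlled norm that is attached to an element `T`: the gradient energies on the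
cut elements and the face terms of the macro element of `T`, and the jumps over the cut faces
of `T`. -/
noncomputable def localEnergy (P : MacroPartition S D γ N) (h : ℝ) (v : S → (Space d →ᵃ[ℝ] ℝ))
    (T : S) : ℝ :=
  (∑ M ∈ P.macros with T.1 ∈ M,
    ((∑ T' : S with T'.1 ∈ M, cutEnergy D v T') + faceStab h v (interiorFaces M))) +
  h⁻¹ * ∑ F ∈ interiorFaces S with F ⊆ T.1, ∫ x in simplex F ∩ D, jumpSq v F x ∂(μHE[d - 1])

variable {P : MacroPartition S D γ N} {h : ℝ} {v : S → (Space d →ᵃ[ℝ] ℝ)}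

theorem cutEnergy_nonneg (T : S) : 0 ≤ cutEnergy D v T :=
  integral_nonneg fun _ => sq_nonneg _

theorem cutEnergy_eq (T : S) :
    cutEnergy D v T = volume.real (simplex T.1 ∩ D) * ‖gradient (v T) 0‖ ^ 2 := by
  simp only [cutEnergy, gradient_affineMap_eq (v T), setIntegral_const, smul_eq_mul]

theorem macro_terms_nonneg (hh : 0 < h) (M : Finset (Finset (Space d))) :
    0 ≤ (∑ T' : S with T'.1 ∈ M, cutEnergy D v T') + faceStab h v (interiorFaces M) :=
  add_nonneg (Finset.sum_nonneg fun T _ => cutEnergy_nonneg T) (faceStab_nonneg v hh _)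

theorem macro_terms_le_localEnergy (hh : 0 < h) {M : Finset (Finset (Space d))} (hM : M ∈ P.macros)
    {T : S} (hT : T.1 ∈ M) :
    (∑ T' : S with T'.1 ∈ M, cutEnergy D v T') + faceStab h v (interiorFaces M) ≤
      localEnergy P h v T := by
  have h1 := Finset.single_le_sum (f := fun M => (∑ T' : S with T'.1 ∈ M, cutEnergy D v T') +
    faceStab h v (interiorFaces M)) (s := P.macros.filter fun M => T.1 ∈ M)
    (fun M _ => macro_terms_nonneg hh M) (Finset.mem_filter.2 ⟨hM, hT⟩)
  refine h1.trans (le_add_of_nonneg_right ?_)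
  have : 0 ≤ ∑ F ∈ interiorFaces S with F ⊆ T.1,
      ∫ x in simplex F ∩ D, jumpSq v F x ∂(μHE[d - 1]) :=
    Finset.sum_nonneg fun F _ => setIntegral_jumpSq_nonneg _
  positivity

theorem cutEnergy_le_localEnergy (hh : 0 < h) {M : Finset (Finset (Space d))} (hM : M ∈ P.macros)
    {T T' : S} (hT : T.1 ∈ M) (hT' : T'.1 ∈ M) : cutEnergy D v T' ≤ localEnergy P h v T := by
  refine le_trans ?_ (macro_terms_le_localEnergy hh hM hT)
  refine le_trans ?_ (le_add_of_nonneg_right (faceStab_nonneg v hh _))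
  exact Finset.single_le_sum (f := fun T' => cutEnergy D v T') (fun T _ => cutEnergy_nonneg T)
    (by simpa using hT')

theorem faceStab_le_localEnergy (hh : 0 < h) {M : Finset (Finset (Space d))} (hM : M ∈ P.macros)
    {T : S} (hT : T.1 ∈ M) : faceStab h v (interiorFaces M) ≤ localEnergy P h v T :=
  le_trans (le_add_of_nonneg_left (Finset.sum_nonneg fun T _ => cutEnergy_nonneg T))
    (macro_terms_le_localEnergy hh hM hT)

theorem cutJump_le_localEnergy (hh : 0 < h) {F : Finset (Space d)} (hF : F ∈ interiorFaces S)
    {T : S} (hFT : F ⊆ T.1) :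
    ∫ x in simplex F ∩ D, jumpSq v F x ∂(μHE[d - 1]) ≤ h * localEnergy P h v T := by
  rw [← inv_mul_le_iff₀ hh]
  have h1 := Finset.single_le_sum (f := fun F => ∫ x in simplex F ∩ D, jumpSq v F x ∂(μHE[d - 1]))
    (s := (interiorFaces S).filter fun F => F ⊆ T.1)
    (fun F _ => setIntegral_jumpSq_nonneg _) (Finset.mem_filter.2 ⟨hF, hFT⟩)
  have h2 : h⁻¹ * ∫ x in simplex F ∩ D, jumpSq v F x ∂(μHE[d - 1]) ≤
      h⁻¹ * ∑ F ∈ interiorFaces S with F ⊆ T.1,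
        ∫ x in simplex F ∩ D, jumpSq v F x ∂(μHE[d - 1]) := by gcongr
  exact h2.trans (le_add_of_nonneg_left (Finset.sum_nonneg fun M _ => macro_terms_nonneg hh M))

theorem localEnergy_nonneg (hh : 0 < h) (T : S) : 0 ≤ localEnergy P h v T := by
  have h1 : 0 ≤ ∑ M ∈ P.macros with T.1 ∈ M,
      ((∑ T' : S with T'.1 ∈ M, cutEnergy D v T') + faceStab h v (interiorFaces M)) :=
    Finset.sum_nonneg fun M _ => macro_terms_nonneg hh M
  have h2 : 0 ≤ ∑ F ∈ interiorFaces S with F ⊆ T.1,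
      ∫ x in simplex F ∩ D, jumpSq v F x ∂(μHE[d - 1]) :=
    Finset.sum_nonneg fun F _ => setIntegral_jumpSq_nonneg _
  unfold localEnergy
  positivity

/-- The local energies have a bounded overlap. -/
theorem sum_localEnergy_le (hh : 0 < h) {K : ℝ}
    (hKM : ∀ M ∈ P.macros, ((Finset.univ.filter fun T : S => T.1 ∈ M).card : ℝ) ≤ K)
    (hKF : ∀ F ∈ interiorFaces S, ((Finset.univ.filter fun T : S => F ⊆ T.1).card : ℝ) ≤ K) :
    ∑ T, localEnergy P h v T ≤ K * (cutGradNormSq D v + h⁻¹ * cutJumpNormSq D v +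
      ∑ M ∈ P.macros, faceStab h v (interiorFaces M)) := by
  have hswap : ∀ {ι : Type _} (A : Finset ι) (p : S → ι → Prop)
      [∀ T, DecidablePred (p T)] (f : ι → ℝ), ∑ T : S, ∑ j ∈ A with p T j, f j =
        ∑ j ∈ A, ((Finset.univ.filter fun T : S => p T j).card : ℝ) * f j := by
    intro ι A p _ f
    simp only [Finset.sum_filter]
    rw [Finset.sum_comm]
    refine Finset.sum_congr rfl fun j _ => ?_
    rw [← Finset.sum_filter, Finset.sum_const, nsmul_eq_mul]
  have hgrad : ∑ M ∈ P.macros, ∑ T : S with T.1 ∈ M, cutEnergy D v T = cutGradNormSq D v := by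
    simp only [Finset.sum_filter]
    rw [Finset.sum_comm]
    refine Finset.sum_congr rfl fun T _ => ?_
    obtain ⟨M, ⟨hM, hTM⟩, huniq⟩ := P.existsUnique T.1 T.2
    rw [Finset.sum_eq_single M]
    · rw [if_pos hTM]
      rfl
    · intro M' hM' hne
      exact if_neg fun hT => hne (huniq M' ⟨hM', hT⟩)
    · exact fun h => absurd hM h
  have h1 : ∑ M ∈ P.macros, ((Finset.univ.filter fun T : S => T.1 ∈ M).card : ℝ) *
      ((∑ T' : S with T'.1 ∈ M, cutEnergy D v T') + faceStab h v (interiorFaces M)) ≤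
      ∑ M ∈ P.macros, K *
        ((∑ T' : S with T'.1 ∈ M, cutEnergy D v T') + faceStab h v (interiorFaces M)) :=
    Finset.sum_le_sum fun M hM =>
      mul_le_mul_of_nonneg_right (hKM M hM) (macro_terms_nonneg hh M)
  have h2 : ∑ F ∈ interiorFaces S, ((Finset.univ.filter fun T : S => F ⊆ T.1).card : ℝ) *
      ∫ x in simplex F ∩ D, jumpSq v F x ∂(μHE[d - 1]) ≤
      ∑ F ∈ interiorFaces S, K * ∫ x in simplex F ∩ D, jumpSq v F x ∂(μHE[d - 1]) :=
    Finset.sum_le_sum fun F hF =>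
      mul_le_mul_of_nonneg_right (hKF F hF) (setIntegral_jumpSq_nonneg _)
  simp only [localEnergy]
  rw [Finset.sum_add_distrib, ← Finset.mul_sum, hswap P.macros (fun T M => T.1 ∈ M),
    hswap (interiorFaces S) (fun T F => F ⊆ T.1)]
  rw [← Finset.mul_sum, Finset.sum_add_distrib, hgrad] at h1
  rw [← Finset.mul_sum] at h2
  have h3 := mul_le_mul_of_nonneg_left h2 (inv_nonneg.2 hh.le)
  refine (add_le_add h1 h3).trans (le_of_eq ?_)
  rw [cutJumpNormSq]
  ring

end LocalEnergy

/-! ### Local bounds -/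

section LocalBounds

theorem abs_le_sqrt_mul_sqrt {c H q x : ℝ} (hc : 0 < c) (hH : 0 < H) (hx : c * H * x ^ 2 ≤ q) :
    |x| ≤ √(1 / c) * √(q / H) := by
  rw [← Real.sqrt_mul (by positivity)]
  refine Real.abs_le_sqrt ?_
  rw [div_mul_div_comm, one_mul, le_div_iff₀ (by positivity)]
  linarith

theorem abs_le_of_face_bound {d : ℕ} (hd : 1 ≤ d) {c h q x : ℝ} (hc : 0 < c) (hh : 0 < h)
    (hx : c * h ^ (d - 1) * x ^ 2 ≤ h * q) : |x| ≤ √(1 / c) * (h * √(q / h ^ d)) := by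
  have h1 : c * h ^ d * (x / h) ^ 2 ≤ q := by
    rw [← pow_sub_one_mul (by omega : d ≠ 0) h, div_pow]
    have h2 : c * (h ^ (d - 1) * h) * (x ^ 2 / h ^ 2) = c * h ^ (d - 1) * x ^ 2 / h := by
      field_simp
    rw [h2, div_le_iff₀ hh]
    linarith
  have h3 := abs_le_sqrt_mul_sqrt hc (by positivity) h1
  rw [abs_div, abs_of_pos hh, div_le_iff₀ hh] at h3
  linarith

/-- The difference of two affine functions, estimated from its value at one point and from the
gradients. -/
theorem abs_sub_le_of_link {d : ℕ} {f g : Space d →ᵃ[ℝ] ℝ} {x p : Space d} {a b L h β : ℝ}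
    (hp : |f p - g p| ≤ a * (h * β)) (hf : ‖gradient f 0‖ ≤ b * β) (hg : ‖gradient g 0‖ ≤ b * β)
    (hxp : dist x p ≤ L * h) : |f x - g x| ≤ (a + 2 * (b * L)) * (h * β) := by
  have hb : 0 ≤ b * β := (norm_nonneg _).trans hf
  have h1 : |f x - f p| ≤ b * β * (L * h) := (abs_sub_le_norm_gradient_mul_dist f x p).trans
    (mul_le_mul hf hxp dist_nonneg hb)
  have h2 : |g x - g p| ≤ b * β * (L * h) := (abs_sub_le_norm_gradient_mul_dist g x p).trans
    (mul_le_mul hg hxp dist_nonneg hb)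
  rw [abs_le] at *
  constructor <;> linarith [h1.1, h1.2, h2.1, h2.2, hp.1, hp.2]

variable {d : ℕ} {Ω D : Set (Space d)} {𝒯 : Mesh Ω} {σ κ h γ : ℝ} {N : ℕ}
  {P : MacroPartition (𝒯.active D) D γ N} {v : 𝒯.active D → (Space d →ᵃ[ℝ] ℝ)}

/-- The constant in the bound of the gradient on an element by the local energy. -/
noncomputable def gradConst (d : ℕ) (σ κ γ : ℝ) (N : ℕ) : ℝ :=
  √(1 / (γ / κ ^ d)) + N * √(1 / Mesh.faceConst d σ κ 1)

theorem gradConst_nonneg : 0 ≤ gradConst d σ κ γ N := by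
  unfold gradConst
  positivity

theorem LargeIntersection.le_volume (H : 𝒯.IsRegular σ κ h) (hγ : 0 < γ) {T : Finset (Space d)}
    (hT : T ∈ 𝒯.elements) (hl : LargeIntersection D γ T) :
    γ / κ ^ d * h ^ d ≤ volume.real (simplex T ∩ D) := by
  have := H.κ_pos
  have := H.h_pos
  have h1 := (le_div_iff₀ (pow_pos (H.size_pos hT) d)).1 hl
  refine le_trans ?_ h1
  have h2 := (H.quasiUniform T hT).1
  calc γ / κ ^ d * h ^ d = γ * (h / κ) ^ d := by rw [div_pow]; ring
    _ ≤ γ * Mesh.size T ^ d := by gcongr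

/-- Across an interior face of a macro element the gradient is controlled by the local energy. -/
theorem norm_gradient_sub_le (H : 𝒯.IsRegular σ κ h) (hd : 2 ≤ d)
    {M : Finset (Finset (Space d))} (hM : M ∈ P.macros) {T T' T₀ : 𝒯.active D} (hT₀ : T₀.1 ∈ M)
    (hT : T.1 ∈ M) (hT' : T'.1 ∈ M) (hadj : FaceNeighbours T.1 T'.1) :
    ‖gradient (v T) 0 - gradient (v T') 0‖ ≤
      √(1 / Mesh.faceConst d σ κ 1) * √(localEnergy P h v T₀ / h ^ d) := by
  have hh := H.h_pos
  obtain ⟨hne, F, hF, hFT, hFT'⟩ := hadj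
  have hTe := 𝒯.active_subset D T.2
  have hFM := mem_interiorFaces_of_subset hT hT' hne hF hFT hFT'
  obtain ⟨q, hq⟩ : F.Nonempty := Finset.card_pos.1 (by omega)
  have h1 := H.faceConst_mul_le hd hTe hFT hF one_pos (subset_convexHull ℝ _ hq)
    (Set.subset_univ _)
  rw [Set.inter_univ] at h1
  have h2 := mul_sq_norm_sub_le (v := v) hFT hFT' (fun h => hne (congrArg Subtype.val h))
  have h3 := (setIntegral_gradJumpSq_le_faceStab (v := v) hh hFM).trans
    (faceStab_le_localEnergy (P := P) hh hM hT₀)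
  have h4 : Mesh.faceConst d σ κ 1 * h ^ d * ‖gradient (v T) 0 - gradient (v T') 0‖ ^ 2 ≤
      localEnergy P h v T₀ := by
    refine le_trans ?_ h3
    rw [← pow_sub_one_mul (by omega : d ≠ 0) h]
    calc Mesh.faceConst d σ κ 1 * (h ^ (d - 1) * h) * ‖gradient (v T) 0 - gradient (v T') 0‖ ^ 2
        = h * (Mesh.faceConst d σ κ 1 * h ^ (d - 1) *
          ‖gradient (v T) 0 - gradient (v T') 0‖ ^ 2) := by ring
      _ ≤ h * ((μHE[d - 1] : Measure (Space d)).real (simplex F) *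
          ‖gradient (v T) 0 - gradient (v T') 0‖ ^ 2) := by gcongr
      _ ≤ _ := by gcongr
  have h5 := abs_le_sqrt_mul_sqrt (Mesh.faceConst_pos H.σ_pos H.κ_pos one_pos) (by positivity) h4
  rwa [abs_norm] at h5

theorem norm_gradient_le (H : 𝒯.IsRegular σ κ h) (hd : 2 ≤ d) (hγ : 0 < γ) (T : 𝒯.active D) :
    ‖gradient (v T) 0‖ ≤ gradConst d σ κ γ N * √(localEnergy P h v T / h ^ d) := by
  have hh := H.h_pos
  have hκ := H.κ_pos
  obtain ⟨M, ⟨hM, hTM⟩, -⟩ := P.existsUnique T.1 T.2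
  obtain ⟨R, hR, hlarge, hchain⟩ := P.exists_root hM
  have h1 := hchain (Space d) (fun T => gradient (v T) 0)
    (√(1 / Mesh.faceConst d σ κ 1) * √(localEnergy P h v T / h ^ d)) (by positivity)
    (fun T₁ T₂ h₁ h₂ hadj => by
      rw [dist_eq_norm]
      exact norm_gradient_sub_le (P := P) (v := v) H hd hM hTM h₁ h₂ hadj) T hTM
  have h2 : γ / κ ^ d * h ^ d * ‖gradient (v R) 0‖ ^ 2 ≤ localEnergy P h v T := by
    refine le_trans ?_ (cutEnergy_le_localEnergy hh hM hTM hR)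
    rw [cutEnergy_eq]
    have := hlarge.le_volume H hγ (𝒯.active_subset D R.2)
    gcongr
  have h3 := abs_le_sqrt_mul_sqrt (by positivity) (by positivity) h2
  rw [abs_norm] at h3
  rw [dist_eq_norm] at h1
  have h4 := norm_le_norm_add_norm_sub' (gradient (v T) 0) (gradient (v R) 0)
  rw [gradConst, add_mul]
  linarith

/-- Across an interior face of a macro element the values are linked at some point of the face. -/
theorem exists_link_of_macro (H : 𝒯.IsRegular σ κ h) (hd : 2 ≤ d)
    {M : Finset (Finset (Space d))} (hM : M ∈ P.macros) {T T' T₀ : 𝒯.active D} (hT₀ : T₀.1 ∈ M)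
    (hT : T.1 ∈ M) (hT' : T'.1 ∈ M) (hadj : FaceNeighbours T.1 T'.1) :
    ∃ p ∈ simplex T.1, |v T p - v T' p| ≤
      √(1 / Mesh.faceConst d σ κ 1) * (h * √(localEnergy P h v T₀ / h ^ d)) := by
  have hh := H.h_pos
  obtain ⟨hne, F, hF, hFT, hFT'⟩ := hadj
  have hTe := 𝒯.active_subset D T.2
  have hFM := mem_interiorFaces_of_subset hT hT' hne hF hFT hFT'
  have hc := Mesh.faceConst_pos (d := d) H.σ_pos H.κ_pos one_pos
  obtain ⟨q, hq⟩ : F.Nonempty := Finset.card_pos.1 (by omega)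
  have h1 := H.faceConst_mul_le hd hTe hFT hF one_pos (subset_convexHull ℝ _ hq)
    (Set.subset_univ _)
  rw [Set.inter_univ] at h1
  obtain ⟨p, hp, h2⟩ := exists_mul_sq_sub_le (v := v) subset_rfl
    (Mesh.measure_face_lt_top (by omega) hTe hFT hF) (by positivity) h1 hFT hFT'
    (fun h => hne (congrArg Subtype.val h))
  refine ⟨p, simplex_mono hFT hp, abs_le_of_face_bound (by omega) hc hh (h2.trans ?_)⟩
  refine (setIntegral_jumpSq_le_faceStab hh hFM).trans ?_
  have := faceStab_le_localEnergy (P := P) (v := v) hh hM hT₀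
  gcongr

/-- Across a face that meets a corridor the values are linked at some point of the cut face. -/
theorem exists_link_of_adjAcross (H : 𝒯.IsRegular σ κ h) (hd : 2 ≤ d) {U : Set (Space d)} {c : ℝ}
    (hc : 0 < c) (hU : ∀ x ∈ U, Metric.ball x (c * h) ⊆ D) {T T' : 𝒯.active D}
    (hadj : 𝒯.AdjAcross U T.1 T'.1) :
    ∃ p ∈ simplex T.1, |v T p - v T' p| ≤
      √(1 / Mesh.faceConst d σ κ c) * (h * √(localEnergy P h v T / h ^ d)) := by
  have hh := H.h_pos
  obtain ⟨hTe, -, hne, F, hF, hFT, hFT', q, hqF, hqU⟩ := hadj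
  have hFS := mem_interiorFaces_of_subset T.2 T'.2 hne hF hFT hFT'
  have hc' := Mesh.faceConst_pos (d := d) H.σ_pos H.κ_pos hc
  have h1 := H.faceConst_mul_le hd hTe hFT hF hc hqF (hU q hqU)
  obtain ⟨p, hp, h2⟩ := exists_mul_sq_sub_le (v := v) (E := simplex F ∩ D) Set.inter_subset_left
    (Mesh.measure_face_lt_top (by omega) hTe hFT hF) (by positivity) h1 hFT hFT'
    (fun h => hne (congrArg Subtype.val h))
  exact ⟨p, simplex_mono hFT hp.1, abs_le_of_face_bound (by omega) hc' hh
    (h2.trans (cutJump_le_localEnergy hh hFS hFT))⟩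

/-- The elements of a macro element lie in a ball of radius of order `h`. -/
theorem dist_le_of_mem_macro (H : 𝒯.IsRegular σ κ h) (hd : 1 ≤ d) {M : Finset (Finset (Space d))}
    (hM : M ∈ P.macros) {T T' : 𝒯.active D} (hT : T.1 ∈ M) (hT' : T'.1 ∈ M) {x y : Space d}
    (hx : x ∈ simplex T.1) (hy : y ∈ simplex T'.1) : dist x y ≤ (4 * N + 2) * κ * h := by
  have hh := H.h_pos
  have hκ := H.κ_pos
  have hel : ∀ T : 𝒯.active D, T.1 ∈ 𝒯.elements := fun T => 𝒯.active_subset D T.2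
  choose p hp using fun T : 𝒯.active D => Mesh.simplex_nonempty (hel T)
  obtain ⟨R, -, -, hchain⟩ := P.exists_root hM
  have h1 := hchain (Space d) p (2 * (κ * h)) (by positivity) (by
    rintro T₁ T₂ - - ⟨-, F, hF, hF₁, hF₂⟩
    obtain ⟨q, hq⟩ : F.Nonempty := Finset.card_pos.1 (by omega)
    have hqF : q ∈ simplex F := subset_convexHull ℝ _ hq
    have h1 := H.dist_le (hel T₁) (hp T₁) (simplex_mono hF₁ hqF)
    have h2 := H.dist_le (hel T₂) (simplex_mono hF₂ hqF) (hp T₂)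
    linarith [dist_triangle (p T₁) q (p T₂)])
  have h2 := h1 T hT
  have h3 := h1 T' hT'
  have h4 := H.dist_le (hel T) hx (hp T)
  have h5 := H.dist_le (hel T') (hp T') hy
  have h6 := dist_triangle4 x (p T) (p T') y
  have h7 := dist_triangle_right (p T) (p T') (p R)
  linarith

/-- The sum of the local energies of the elements at distance at most `R h` from `T`. -/
noncomputable def nearEnergy (P : MacroPartition (𝒯.active D) D γ N) (h R : ℝ)
    (v : 𝒯.active D → (Space d →ᵃ[ℝ] ℝ)) (T : 𝒯.active D) : ℝ :=
  ∑ T' : 𝒯.active D with Mesh.Near (R * h) T.1 T'.1, localEnergy P h v T'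

theorem localEnergy_le_nearEnergy (hh : 0 < h) {R : ℝ} {T T' : 𝒯.active D} {x y : Space d}
    (hx : x ∈ simplex T.1) (hy : y ∈ simplex T'.1) (hxy : dist x y ≤ R * h) :
    localEnergy P h v T' ≤ nearEnergy P h R v T :=
  Finset.single_le_sum (f := fun T' => localEnergy P h v T') (fun T _ => localEnergy_nonneg hh T)
    (Finset.mem_filter.2 ⟨Finset.mem_univ _, x, hx, y, hy, hxy⟩)

/-- Within a macro element the values at a point `x` near the macro element differ by at most a
multiple of the square root of the energy. -/
theorem abs_sub_root_le (H : 𝒯.IsRegular σ κ h) (hd : 2 ≤ d)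
    {M : Finset (Finset (Space d))} (hM : M ∈ P.macros) {T R : 𝒯.active D} (hT : T.1 ∈ M)
    (hchain : ∀ (X : Type) [PseudoMetricSpace X] (f : 𝒯.active D → X) (δ : ℝ), 0 ≤ δ →
        (∀ T T' : 𝒯.active D, T.1 ∈ M → T'.1 ∈ M → FaceNeighbours T.1 T'.1 →
          dist (f T) (f T') ≤ δ) → ∀ T : 𝒯.active D, T.1 ∈ M → dist (f T) (f R) ≤ N * δ)
    {x : Space d} (hx : x ∈ simplex T.1) {β : ℝ}
    (hβ : √(localEnergy P h v T / h ^ d) ≤ β)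
    (hg : ∀ T' : 𝒯.active D, T'.1 ∈ M → ‖gradient (v T') 0‖ ≤ gradConst d σ κ γ N * β) :
    |v T x - v R x| ≤ N * ((√(1 / Mesh.faceConst d σ κ 1) +
      2 * (gradConst d σ κ γ N * ((4 * N + 2) * κ))) * (h * β)) := by
  have hh := H.h_pos
  have hκ := H.κ_pos
  have hβ0 : 0 ≤ β := (Real.sqrt_nonneg _).trans hβ
  have hgc := gradConst_nonneg (d := d) (σ := σ) (κ := κ) (γ := γ) (N := N)
  rw [← Real.dist_eq]
  refine hchain ℝ (fun T => v T x) _ (by positivity) (fun T₁ T₂ h₁ h₂ hadj => ?_) T hT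
  obtain ⟨p, hp, hle⟩ := exists_link_of_macro (P := P) (v := v) H hd hM hT h₁ h₂ hadj
  rw [Real.dist_eq]
  exact abs_sub_le_of_link (hle.trans (by gcongr)) (hg T₁ h₁) (hg T₂ h₂)
    (dist_le_of_mem_macro H (by omega) hM hT h₁ hx hp)

/-- Two elements with a common point `x`: the roots of their macro elements are joined by a
corridor, so that `x` is reached by a bounded number of links. -/
theorem exists_local_bound {h₀ : ℝ} (hd : 2 ≤ d) (hDo : IsOpen D) (hDc : IsConnected D)
    (hDb : Bornology.IsBounded D) (hcone : ∀ x ∈ closure D, LocalCone D x) (hDΩ : D ⊆ Ω)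
    (hh₀ : 0 < h₀) (hσ : 0 < σ) (hκ : 0 < κ) (hγ : 0 < γ) (N : ℕ) :
    ∃ C R : ℝ, 0 ≤ C ∧ 0 ≤ R ∧ (4 * N + 2) * κ ≤ R ∧ ∀ (h : ℝ), h ≤ h₀ →
      ∀ (𝒯 : Mesh Ω), 𝒯.IsRegular σ κ h → ∀ (P : MacroPartition (𝒯.active D) D γ N)
        (v : 𝒯.active D → (Space d →ᵃ[ℝ] ℝ)) (T₀ T₁ T₂ : 𝒯.active D) (x : Space d),
        x ∈ simplex T₀.1 → x ∈ simplex T₁.1 → x ∈ simplex T₂.1 →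
        |v T₁ x - v T₂ x| ≤ C * (h * √(nearEnergy P h R v T₀ / h ^ d)) ∧
        ‖gradient (v T₁) 0‖ ≤ C * √(nearEnergy P h R v T₀ / h ^ d) := by
  set C₀ : ℝ := (4 * N + 2) * κ with hC₀
  have hC₀0 : 0 < C₀ := by positivity
  obtain ⟨R, c, hR, hc, hcor⟩ := exists_corridors (ρ₀ := 1 / (κ * σ)) (γ := γ / κ ^ d) hDo hDc hDb
    hcone hC₀0 (by positivity) (by positivity) hh₀
  set g := gradConst d σ κ γ N with hg
  have hg0 : 0 ≤ g := gradConst_nonneg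
  set a₁ : ℝ := N * (√(1 / Mesh.faceConst d σ κ 1) + 2 * (g * C₀)) with ha₁
  set a₂ : ℝ := √(1 / Mesh.faceConst d σ κ c) + 2 * (g * (R + κ)) with ha₂
  set K : ℝ := ((R + κ + κ) * (κ * σ)) ^ d with hK
  have ha₁0 : 0 ≤ a₁ := by positivity
  have ha₂0 : 0 ≤ a₂ := by positivity
  have hK0 : 0 ≤ K := by positivity
  refine ⟨a₁ + K * a₂ + a₁ + g, R + C₀, by positivity, by positivity, by linarith, ?_⟩
  intro h hhh 𝒯 H P v T₀ T₁ T₂ x hx₀ hx₁ hx₂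
  have hh := H.h_pos
  have hel : ∀ T : 𝒯.active D, T.1 ∈ 𝒯.elements := fun T => 𝒯.active_subset D T.2
  set β := √(nearEnergy P h (R + C₀) v T₀ / h ^ d) with hβ
  have hβ0 : 0 ≤ β := Real.sqrt_nonneg _
  -- Elements that contain a point near `x` have an energy and a gradient bounded by `β`.
  have hen : ∀ T : 𝒯.active D, ∀ y ∈ simplex T.1, dist x y ≤ (R + C₀) * h →
      √(localEnergy P h v T / h ^ d) ≤ β := by
    intro T y hy hxy
    have := localEnergy_le_nearEnergy (P := P) (v := v) hh hx₀ hy hxy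
    exact Real.sqrt_le_sqrt (by gcongr)
  have hgr : ∀ T : 𝒯.active D, ∀ y ∈ simplex T.1, dist x y ≤ (R + C₀) * h →
      ‖gradient (v T) 0‖ ≤ g * β := by
    intro T y hy hxy
    refine (norm_gradient_le (P := P) (v := v) H hd hγ T).trans ?_
    have := hen T y hy hxy
    gcongr
  have hRh : 0 ≤ R * h := by positivity
  have hCh : 0 ≤ C₀ * h := by positivity
  have hxx : dist x x ≤ (R + C₀) * h := by
    rw [dist_self]
    positivity
  have hroot : ∀ T : 𝒯.active D, x ∈ simplex T.1 → ∃ TM : 𝒯.active D,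
      LargeIntersection D γ TM.1 ∧ simplex TM.1 ⊆ Metric.closedBall x (C₀ * h) ∧
      |v T x - v TM x| ≤ a₁ * (h * β) := by
    intro T hxT
    obtain ⟨M, ⟨hM, hTM⟩, -⟩ := P.existsUnique T.1 T.2
    obtain ⟨Q, hQ, hlarge, hchain⟩ := P.exists_root hM
    refine ⟨Q, hlarge, fun y hy => ?_, ?_⟩
    · rw [Metric.mem_closedBall, dist_comm]
      exact dist_le_of_mem_macro H (by omega) hM hTM hQ hxT hy
    · rw [ha₁, mul_assoc]
      refine abs_sub_root_le H hd hM hTM hchain hxT (hen T x hxT hxx) fun T' hT' => ?_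
      obtain ⟨y, hy⟩ := Mesh.simplex_nonempty (hel T')
      refine hgr T' y hy ((dist_le_of_mem_macro H (by omega) hM hTM hT' hxT hy).trans ?_)
      rw [add_mul]
      linarith
  obtain ⟨Q₁, hl₁, hb₁, hv₁⟩ := hroot T₁ hx₁
  obtain ⟨Q₂, hl₂, hb₂, hv₂⟩ := hroot T₂ hx₂
  obtain ⟨U, hUR, hU⟩ := hcor h hh hhh x (simplex Q₁.1) (simplex Q₂.1) (convex_simplex _)
    (convex_simplex _) (isCompact_simplex _).isClosed (isCompact_simplex _).isClosed hb₁ hb₂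
    (Mesh.exists_closedBall_subset hσ H.shapeRegular H.quasiUniform (hel Q₁))
    (Mesh.exists_closedBall_subset hσ H.shapeRegular H.quasiUniform (hel Q₂))
    (hl₁.le_volume H hγ (hel Q₁)) (hl₂.le_volume H hγ (hel Q₂))
  have hUD : U ⊆ D := fun y hy => hU.ball_subset y hy (Metric.mem_ball_self (by positivity))
  have hpath := Mesh.reflTransGen_adjAcross (𝒯 := 𝒯) hU.isOpen hU.isPreconnected
    (hUD.trans (hDΩ.trans subset_closure)) (hel Q₁) (hel Q₂)
    (by rw [Set.inter_comm]; exact hU.left) (by rw [Set.inter_comm]; exact hU.right)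
  set A : Finset (𝒯.active D) := Finset.univ.filter fun T => Mesh.Near (R * h) T₀.1 T.1 with hA
  have hAK : ((A.map (Function.Embedding.subtype (· ∈ 𝒯.active D))).card : ℝ) ≤ K := by
    rw [Finset.card_map]
    exact H.card_near_le hR.le (𝒯.active_subset D) (hel T₀) fun T hT => (Finset.mem_filter.1 hT).2
  set f : Finset (Space d) → ℝ := fun T => if hT : T ∈ 𝒯.active D then v ⟨T, hT⟩ x else 0 with hf
  have hmeet : ∀ T ∈ 𝒯.elements, ∀ q ∈ simplex T, q ∈ U → ∃ hT : T ∈ 𝒯.active D,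
      f T = v ⟨T, hT⟩ x ∧ dist x q ≤ R * h ∧
      T ∈ A.map (Function.Embedding.subtype (· ∈ 𝒯.active D)) := by
    intro T hT q hqT hqU
    have hTa : T ∈ 𝒯.active D := Mesh.mem_active.2 ⟨hT, q, hqT, hUD hqU⟩
    have hxq : dist x q ≤ R * h := by
      rw [dist_comm]
      exact Metric.mem_closedBall.1 (hUR hqU)
    exact ⟨hTa, dif_pos hTa, hxq, Finset.mem_map.2
      ⟨⟨T, hTa⟩, Finset.mem_filter.2 ⟨Finset.mem_univ _, x, hx₀, q, hqT, hxq⟩, rfl⟩⟩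
  have hstep : ∀ T T', 𝒯.AdjAcross U T T' →
      T ∈ A.map (Function.Embedding.subtype (· ∈ 𝒯.active D)) ∧
      T' ∈ A.map (Function.Embedding.subtype (· ∈ 𝒯.active D)) ∧
      dist (f T) (f T') ≤ a₂ * (h * β) := by
    intro T T' hadj
    obtain ⟨hT, hT', -, F, -, hFT, hFT', q, hqF, hqU⟩ := id hadj
    obtain ⟨hTa, hfT, hxq, hTA⟩ := hmeet T hT q (simplex_mono hFT hqF) hqU
    obtain ⟨hTa', hfT', -, hTA'⟩ := hmeet T' hT' q (simplex_mono hFT' hqF) hqU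
    have hxq' : dist x q ≤ (R + C₀) * h := by
      rw [add_mul]
      linarith
    obtain ⟨p, hp, hle⟩ := exists_link_of_adjAcross (P := P) (v := v) H hd hc hU.ball_subset
      (T := ⟨T, hTa⟩) (T' := ⟨T', hTa'⟩) hadj
    refine ⟨hTA, hTA', ?_⟩
    rw [hfT, hfT', Real.dist_eq]
    have hqT : q ∈ simplex (⟨T, hTa⟩ : 𝒯.active D).1 := simplex_mono hFT hqF
    have hqT' : q ∈ simplex (⟨T', hTa'⟩ : 𝒯.active D).1 := simplex_mono hFT' hqF
    have he := hen ⟨T, hTa⟩ q hqT hxq'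
    refine abs_sub_le_of_link (hle.trans (by gcongr)) (hgr _ q hqT hxq') (hgr _ q hqT' hxq') ?_
    have h1 := H.dist_le hT hqT hp
    linarith [dist_triangle x q p]
  have hQ := dist_le_of_reflTransGen (f := f) (by positivity) hstep hpath
  rw [hf, Real.dist_eq] at hQ
  simp only [Finset.coe_mem, dif_pos, Subtype.coe_eta] at hQ
  have hQ' := hQ.trans (mul_le_mul_of_nonneg_right hAK (by positivity))
  have hhβ : 0 ≤ h * β := by positivity
  constructor
  · have h1 := abs_sub_le (v T₁ x) (v Q₁ x) (v T₂ x)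
    have h2 := abs_sub_le (v Q₁ x) (v Q₂ x) (v T₂ x)
    rw [abs_sub_comm (v Q₂ x)] at h2
    have h3 : 0 ≤ g * (h * β) := by positivity
    calc |v T₁ x - v T₂ x| ≤ a₁ * (h * β) + (K * (a₂ * (h * β)) + a₁ * (h * β)) := by linarith
      _ ≤ (a₁ + K * a₂ + a₁ + g) * (h * β) := by linarith
  · have h1 := hgr T₁ x hx₁ hxx
    have h2 : 0 ≤ (a₁ + K * a₂ + a₁) * β := by positivity
    linarith

end LocalBounds

/-! ### The global bound -/

section GlobalBound

variable {d : ℕ} {Ω D : Set (Space d)} {𝒯 : Mesh Ω} {σ κ h γ : ℝ} {N : ℕ}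

theorem sum_nearEnergy_le (H : 𝒯.IsRegular σ κ h) {R : ℝ} (hR : 0 ≤ R)
    (P : MacroPartition (𝒯.active D) D γ N) (v : 𝒯.active D → (Space d →ᵃ[ℝ] ℝ)) :
    ∑ T, nearEnergy P h R v T ≤
      ((R + κ + κ) * (κ * σ)) ^ d * ∑ T, localEnergy P h v T := by
  simp only [nearEnergy, Finset.sum_filter]
  rw [Finset.sum_comm, Finset.mul_sum]
  refine Finset.sum_le_sum fun T _ => ?_
  rw [← Finset.sum_filter, Finset.sum_const, nsmul_eq_mul]
  refine mul_le_mul_of_nonneg_right ?_ (localEnergy_nonneg H.h_pos T)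
  exact H.card_near_le hR (𝒯.active_subset D) (𝒯.active_subset D T.2) fun T' hT' =>
    (Finset.mem_filter.1 hT').2.symm

/-- The sum of a nonnegative quantity over the faces, bounded on each face by a quantity attached to
any element at the face. -/
theorem sum_interiorFaces_le {S : Finset (Finset (Space d))} (hS : ∀ T ∈ S, T.card = d + 1)
    (t : Finset (Space d) → ℝ) (Q : S → ℝ) (hQ : ∀ T, 0 ≤ Q T)
    (ht : ∀ F ∈ interiorFaces S, ∀ T : S, F ⊆ T.1 → t F ≤ Q T) :
    ∑ F ∈ interiorFaces S, t F ≤ 2 ^ (d + 1) * ∑ T, Q T := by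
  have h1 : ∑ F ∈ interiorFaces S, t F ≤
      ∑ F ∈ interiorFaces S, ∑ T : S, if F ⊆ T.1 then Q T else 0 := by
    refine Finset.sum_le_sum fun F hF => ?_
    obtain ⟨-, T, hT, hFT⟩ := exists_of_mem_interiorFaces hF
    rw [← Finset.sum_filter]
    exact (ht F hF ⟨T, hT⟩ hFT).trans (Finset.single_le_sum (f := fun T => Q T) (fun T _ => hQ T)
      (Finset.mem_filter.2 ⟨Finset.mem_univ _, hFT⟩))
  refine h1.trans ?_
  rw [Finset.sum_comm, Finset.mul_sum]
  refine Finset.sum_le_sum fun T _ => ?_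
  rw [← Finset.sum_filter, Finset.sum_const, nsmul_eq_mul]
  refine mul_le_mul_of_nonneg_right ?_ (hQ T)
  have h2 : (interiorFaces S).filter (fun F => F ⊆ T.1) ⊆ T.1.powerset := fun F hF =>
    Finset.mem_powerset.2 (Finset.mem_filter.1 hF).2
  have h3 := Finset.card_le_card h2
  rw [Finset.card_powerset, hS T.1 T.2] at h3
  exact_mod_cast h3

/-- The bound of the face terms for a domain `D` with the interior cone property. -/
theorem exists_faceStab_le {h₀ : ℝ} (hd : 2 ≤ d) (hDo : IsOpen D) (hDc : IsConnected D)
    (hDb : Bornology.IsBounded D) (hcone : ∀ x ∈ closure D, LocalCone D x) (hDΩ : D ⊆ Ω)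
    (hh₀ : 0 < h₀) (hσ : 0 < σ) (hκ : 0 < κ) (hγ : 0 < γ) (N : ℕ) :
    ∃ C : ℝ, 0 < C ∧ ∀ (h : ℝ), h ≤ h₀ →
      ∀ (𝒯 : Mesh Ω), 𝒯.IsRegular σ κ h → ∀ (P : MacroPartition (𝒯.active D) D γ N)
        (v : 𝒯.active D → (Space d →ᵃ[ℝ] ℝ)),
        faceStab h v (interiorFaces (𝒯.active D)) ≤
          C * (cutGradNormSq D v + h⁻¹ * cutJumpNormSq D v
            + ∑ M ∈ P.macros, faceStab h v (interiorFaces M)) := by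
  obtain ⟨C, R, hC, hR, hNR, hloc⟩ :=
    exists_local_bound hd hDo hDc hDb hcone hDΩ hh₀ hσ hκ hγ N
  set K : ℝ := ((R + κ + κ) * (κ * σ)) ^ d with hK
  have hK0 : 0 ≤ K := by positivity
  set m : ℝ := κ ^ (d - 1) * volume.real (Metric.closedBall (0 : Space (d - 1)) 1) with hm
  have hm0 : 0 ≤ m := by positivity
  set C' : ℝ := 5 * m * K ^ 2 * C ^ 2 with hC'
  have hC'0 : 0 ≤ C' := by positivity
  refine ⟨2 ^ (d + 1) * C' * K * K + 1, by positivity, ?_⟩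
  intro h hhh 𝒯 H P v
  have hh := H.h_pos
  have hel : ∀ T : 𝒯.active D, T.1 ∈ 𝒯.elements := fun T => 𝒯.active_subset D T.2
  have hcardF : ∀ F : Finset (Space d), F.card = d → ∀ T₀ : 𝒯.active D, F ⊆ T₀.1 →
      ((Finset.univ.filter fun T : 𝒯.active D => F ⊆ T.1).card : ℝ) ≤ K := by
    intro F hF T₀ hFT₀
    obtain ⟨q, hq⟩ : F.Nonempty := Finset.card_pos.1 (by omega)
    have hqF : q ∈ simplex F := subset_convexHull ℝ _ hq
    refine H.card_near_le hR (𝒯.active_subset D) (hel T₀) fun T hT => ?_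
    refine ⟨q, simplex_mono hFT₀ hqF, q, simplex_mono (Finset.mem_filter.1 hT).2 hqF, ?_⟩
    rw [dist_self]
    positivity
  have hcardM : ∀ M ∈ P.macros,
      ((Finset.univ.filter fun T : 𝒯.active D => T.1 ∈ M).card : ℝ) ≤ K := by
    intro M hM
    obtain ⟨Q, hQ, -⟩ := P.exists_root hM
    refine H.card_near_le hR (𝒯.active_subset D) (hel Q) fun T hT => ?_
    obtain ⟨x, hx⟩ := Mesh.simplex_nonempty (hel Q)
    obtain ⟨y, hy⟩ := Mesh.simplex_nonempty (hel T)
    refine ⟨x, hx, y, hy, ?_⟩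
    refine (dist_le_of_mem_macro H (by omega) hM hQ (Finset.mem_filter.1 hT).2 hx hy).trans ?_
    gcongr
  have hnear : ∀ T, 0 ≤ nearEnergy P h R v T := fun T =>
    Finset.sum_nonneg fun T' _ => localEnergy_nonneg hh T'
  have hface : ∀ F ∈ interiorFaces (𝒯.active D), ∀ T₀ : 𝒯.active D, F ⊆ T₀.1 →
      h⁻¹ * ∫ x in simplex F, jumpSq v F x ∂(μHE[d - 1]) +
        h * ∫ x in simplex F, gradJumpSq v F x ∂(μHE[d - 1]) ≤ C' * nearEnergy P h R v T₀ := by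
    intro F hF T₀ hFT₀
    obtain ⟨hFc, -⟩ := exists_of_mem_interiorFaces hF
    obtain ⟨q, hq⟩ : F.Nonempty := Finset.card_pos.1 (by omega)
    have hqF : q ∈ simplex F := subset_convexHull ℝ _ hq
    set β := √(nearEnergy P h R v T₀ / h ^ d) with hβ
    have hβsq : β ^ 2 = nearEnergy P h R v T₀ / h ^ d :=
      Real.sq_sqrt (div_nonneg (hnear T₀) (by positivity))
    have hbound := face_terms_le (v := v) (F := F) (A := (C * (h * β)) ^ 2)
      (B := (2 * (C * β)) ^ 2) hh (sq_nonneg _) (sq_nonneg _) (hcardF F hFc T₀ hFT₀)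
      (Mesh.measure_face_lt_top (by omega) (hel T₀) hFT₀ hFc)
      (H.face_measure_real_le (by omega) (hel T₀) hFT₀ hFc)
      (fun T₁ T₂ h₁ h₂ x hx => by
        have := (hloc h hhh 𝒯 H P v T₀ T₁ T₂ x (simplex_mono hFT₀ hx) (simplex_mono h₁ hx)
          (simplex_mono h₂ hx)).1
        rw [← sq_abs]
        gcongr)
      (fun T₁ T₂ h₁ h₂ => by
        have e₁ := (hloc h hhh 𝒯 H P v T₀ T₁ T₁ q (simplex_mono hFT₀ hqF) (simplex_mono h₁ hqF)
          (simplex_mono h₁ hqF)).2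
        have e₂ := (hloc h hhh 𝒯 H P v T₀ T₂ T₂ q (simplex_mono hFT₀ hqF) (simplex_mono h₂ hqF)
          (simplex_mono h₂ hqF)).2
        have e₃ : ‖gradient (v T₁) 0 - gradient (v T₂) 0‖ ≤ 2 * (C * β) :=
          (norm_sub_le _ _).trans (by linarith)
        gcongr)
    refine hbound.trans (le_of_eq ?_)
    have hhd : h ^ d = h ^ (d - 1) * h := (pow_sub_one_mul (by omega) h).symm
    calc h⁻¹ * (m * h ^ (d - 1) * (K ^ 2 * (C * (h * β)) ^ 2)) +
          h * (m * h ^ (d - 1) * (K ^ 2 * (2 * (C * β)) ^ 2))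
        = 5 * m * K ^ 2 * C ^ 2 * (h ^ (d - 1) * h * β ^ 2) := by
          field_simp
          ring
      _ = C' * nearEnergy P h R v T₀ := by
          rw [← hhd, hβsq, hC']
          field_simp
  have hsum := sum_interiorFaces_le
    (fun T hT => (𝒯.mem_elements.1 (𝒯.active_subset D hT)).2) _ _
    (fun T => mul_nonneg hC'0 (hnear T)) hface
  rw [← Finset.mul_sum] at hsum
  have h1 := sum_nearEnergy_le H hR P v
  have h2 := sum_localEnergy_le (P := P) (v := v) hh hcardM fun F hF => by
    obtain ⟨hFc, T, hT, hFT⟩ := exists_of_mem_interiorFaces hF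
    exact hcardF F hFc ⟨T, hT⟩ hFT
  set E := cutGradNormSq D v + h⁻¹ * cutJumpNormSq D v +
    ∑ M ∈ P.macros, faceStab h v (interiorFaces M) with hE
  have hE0 : 0 ≤ E := by
    have e1 : 0 ≤ cutGradNormSq D v := Finset.sum_nonneg fun T _ => cutEnergy_nonneg T
    have e2 : 0 ≤ cutJumpNormSq D v := Finset.sum_nonneg fun F _ => setIntegral_jumpSq_nonneg _
    have e3 : 0 ≤ ∑ M ∈ P.macros, faceStab h v (interiorFaces M) :=
      Finset.sum_nonneg fun M _ => faceStab_nonneg v hh _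
    positivity
  calc faceStab h v (interiorFaces (𝒯.active D))
      ≤ 2 ^ (d + 1) * (C' * ∑ T, nearEnergy P h R v T) := hsum
    _ ≤ 2 ^ (d + 1) * (C' * (K * (K * E))) := by
        gcongr
        exact h1.trans (mul_le_mul_of_nonneg_left h2 hK0)
    _ = 2 ^ (d + 1) * C' * K * K * E := by ring
    _ ≤ (2 ^ (d + 1) * C' * K * K + 1) * E := by linarith

end GlobalBound

end CutDG

theorem mainTheorem4 (d : ℕ) (hd : d = 2 ∨ d = 3) (G : CutDG.Geometry d) (i : Fin 2)
    (h₀ σ κ γ : ℝ) (N : ℕ) (hh₀ : 0 < h₀) (hσ : 0 < σ) (hκ : 0 < κ) (hγ : 0 < γ) :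
    ∃ C : ℝ, 0 < C ∧
      ∀ (h : ℝ), 0 < h → h ≤ h₀ →
      ∀ (𝒯 : CutDG.Mesh G.Ω), 𝒯.ShapeRegular σ → 𝒯.QuasiUniform κ h →
      ∀ (P : CutDG.MacroPartition (𝒯.active (G.bulk i)) (G.bulk i) γ N),
      ∀ v ∈ 𝒯.activeSpace (G.bulk i),
        CutDG.faceStab h v (CutDG.interiorFaces (𝒯.active (G.bulk i))) ≤
          C * (CutDG.cutGradNormSq (G.bulk i) v
            + h⁻¹ * CutDG.cutJumpNormSq (G.bulk i) v
            + ∑ M ∈ P.macros, CutDG.faceStab h v (CutDG.interiorFaces M)) := by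
  obtain ⟨C, hC, H⟩ := CutDG.exists_faceStab_le (by omega) (G.isOpen_bulk i) (G.isConnected_bulk i)
    (G.isBounded_domain.subset (G.bulk_subset i)) (fun x hx => G.localCone_bulk i hx)
    (G.bulk_subset i) hh₀ hσ hκ hγ N
  exact ⟨C, hC, fun h hh hhh 𝒯 hreg hqu P v _ => H h hhh 𝒯 ⟨hσ, hκ, hh, hreg, hqu⟩ P v⟩
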